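/- **Setting.** An agent's type $\theta$ has support $\Theta=[\underline\theta,\bar\theta]$, $0\le\underline\theta<\bar\theta$, with a density $f$ that is continuous and positive on $\Theta$; put $f=0$ off $\Theta$ and let $F$ be the CDF. Type $\theta$ chooses a quality $q\in Q=[0,q_{\max}]$, $q_{\max}>0$, at cost $c(q)/\theta$, where $c\in C^2(Q)$, $c(0)=c'(0)=0$, $c''(q)>0$ for $q>0$, and $c(q_{\max})=\bar\theta q_{\max}$. The principal's utility $v(q,\theta)$ is $C^2$ on $Q\times\Theta$ with $v_{qq}\le 0$, $v(0,\theta)=0$, $v_q(0,\theta)>0$. For $\theta\in[0,\bar\theta]$ let $q_f(\theta)\in Q$ be the solution of $c'(q)=\theta$, and $q_i(\theta)\in Q$ the solution of $c(q)/q=\theta$ ($q_i(0)=0$); let $\theta_c(\theta)=c'(q_i(\theta))$. Assume downward bias: $v_q(q_f(\theta),\theta)\ge 0$ for all $\theta\in\Theta$. **Ratings.** A deterministic rating is a map $\pi$ from $Q$ to a set of scores. Given $\pi$, each type either opts out (quality $0$, wage $0$, payoff $0$) or takes the test with a quality $q$ and obtains $\omega(\pi(q))-c(q)/\theta$ (equivalently,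 $\theta\omega(\pi(q))-c(q)$, which is also used if $\theta=0$), where the wage $\omega(s)$ is the market's expectation of the quality given the score $s$; the belief is supported on the qualities chosen by the types that obtain $s$, or, if there are none, on $\{q\in Q:\pi(q)=s\}$. In equilibrium all types choose optimally. A rating with an equilibrium quality scheme $q(\cdot)$ is optimal if it maximizes $\int_{\underline\theta}^{\bar\theta} v(q(\theta),\theta)f(\theta)\,d\theta$ over all deterministic ratings and their equilibria. With minimum standard $q_0$, lower censorship reveals $q$ if $q\ge q_0$ and gives "fail" otherwise; the pass/fail test gives "pass" if $q\ge q_0$ and "fail" otherwise; the fully revealing test has $\pi(q)=q$. A rating has cutoff type $\theta_0\in[0,\bar\theta]$ if $q_0=q_i(\theta_0)$. **The function $r$.** Let $\kappa=\inf_{0<q\le q_{\max},\,\theta\in\Theta}\{-v_{qq}(q,\theta)/c''(q)\}$. For a cutoff $\theta_0$ let $q(\theta)=0$ if $\theta<\theta_0$, $q(\theta)=q_i(\theta_0)$ if $\theta_0\le\theta<\theta_c(\theta_0)$, $q(\theta)=q_f(\theta)$ if $\theta\ge\max\{\theta_0,\theta_c(\theta_0)\}$, and let $$r(\theta)=r_{\theta_0}(\theta)=v_q(q(\theta),\theta)f(\theta)-\kappa\,(\theta-c'(q(\theta)))f(\theta)-\kappa\,(F(\theta)-F(\theta_0)),\qquad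 \theta\ge0,$$ the terms with $f(\theta)$ being $0$ for $\theta\notin\Theta$. Let $A(\theta_0)=\frac1{\theta_c(\theta_0)-\theta_0}\int_{\theta_0}^{\theta_c(\theta_0)}r(\theta)\,d\theta$ (and $A(0)=r(0+)$ for $\theta_0=0$), and let $\theta_L(\theta_0)=\max\{\min\{\theta_c(\theta_0),\bar\theta\},\underline\theta\}$. - (S) at $\theta_0$: $A(\theta_0)>0$ and $\int_{\theta_0}^{\theta}r(x)\,dx\ge A(\theta_0)(\theta-\theta_0)$ for all $\theta\in[0,\theta_L(\theta_0)]$. - (C) at $\theta_0$: $r$ is (weakly) decreasing on $(\theta_L(\theta_0),\bar\theta]$. $r$ is quasi-unimodal if (S) and (C) hold at some $\theta_0\in[0,\bar\theta]$; quasi-increasing if (S) holds at some $\theta_0\in[0,\bar\theta]$ with $\theta_c(\theta_0)\ge\bar\theta$; quasi-decreasing if (S) and (C) hold at some $\theta_0\in[0,\bar\theta]$ with $\theta_0\le\underline\theta$. **Proposition.** 1. If $r$ is quasi-unimodal, with (S) and (C) satisfied at $\theta_0$, then lower censorship with cutoff type $\theta_0$ is an optimal deterministic rating, with the quality scheme $q(\theta)$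 above. 2. If $r$ is quasi-increasing, with (S) satisfied at $\theta_0$, $\theta_c(\theta_0)\ge\bar\theta$, then the pass/fail test with cutoff type $\theta_0$ is an optimal deterministic rating, with the quality scheme $q(\theta)=0$ for $\theta<\theta_0$ and $q(\theta)=q_i(\theta_0)$ for $\theta\ge\theta_0$. 3. If $r$ is quasi-decreasing, with (S) and (C) satisfied at $\theta_0\le\underline\theta$, then lower censorship with cutoff type $\theta_0$ is an optimal deterministic rating and its quality scheme induces no exclusion: every type $\theta\in\Theta$, $\theta>0$, chooses a positive quality. 4. If $r=r_0$ (that is, $r$ for $\theta_0=0$, where $q(\theta)=q_f(\theta)$ on $\Theta$) is (weakly) decreasing on $\mathbb R_+$, then the fully revealing test is an optimal deterministic rating, with the quality scheme $q_f$. -/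

import Mathlib

open Set MeasureTheory

noncomputable section

/-- The primitives of the rating-design problem together with the standing assumptions.
`lo`, `hi` are the end points of the type space, `f` is the density of types (extended by `0`),
`c q / θ` is the cost of quality `q` for type `θ`, `v q θ` is the principal's utility and
`qmax` is the highest quality, namely the one at which type `hi` is indifferent to the
outside option. -/
structure RatingModel where
  lo : ℝ
  hi : ℝ
  qmax : ℝ
  f : ℝ → ℝ
  c : ℝ → ℝ
  v : ℝ → ℝ → ℝ
  lo_nonneg : 0 ≤ lo
  lo_lt_hi : lo < hi
  f_cont : ContinuousOn f (Icc lo hi)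
  f_pos : ∀ θ ∈ Icc lo hi, 0 < f θ
  f_zero : ∀ θ, θ ∉ Icc lo hi → f θ = 0
  f_mass : ∫ θ, f θ = 1
  qmax_pos : 0 < qmax
  c_smooth : ContDiffOn ℝ 2 c (Icc 0 qmax)
  c_zero : c 0 = 0
  c_deriv_zero : derivWithin c (Icc 0 qmax) 0 = 0
  c_convex : ∀ q ∈ Ioc 0 qmax, 0 < derivWithin (derivWithin c (Icc 0 qmax)) (Icc 0 qmax) q
  c_qmax : c qmax = hi * qmax
  v_smooth : ContDiffOn ℝ 2 (fun p : ℝ × ℝ => v p.1 p.2) (Icc 0 qmax ×ˢ Icc lo hi)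
  v_zero : ∀ θ ∈ Icc lo hi, v 0 θ = 0
  v_deriv_pos : ∀ θ ∈ Icc lo hi, 0 < derivWithin (fun q => v q θ) (Icc 0 qmax) 0
  v_concave : ∀ q ∈ Icc 0 qmax, ∀ θ ∈ Icc lo hi,
    derivWithin (derivWithin (fun x => v x θ) (Icc 0 qmax)) (Icc 0 qmax) q ≤ 0
  /-- Downward bias: the principal weakly prefers a marginally higher quality than the one
  that a type `θ` chooses under full revelation. -/
  downward_bias : ∀ θ ∈ Icc lo hi, ∀ q ∈ Icc 0 qmax,
    derivWithin c (Icc 0 qmax) q = θ → 0 ≤ derivWithin (fun x => v x θ) (Icc 0 qmax) q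

namespace RatingModel

variable (M : RatingModel)

/-- The set of types. -/
def types : Set ℝ := Icc M.lo M.hi

/-- The set of feasible qualities. -/
def qualities : Set ℝ := Icc 0 M.qmax

/-- The cumulative distribution function of types. -/
def F (θ : ℝ) : ℝ := ∫ x in Iic θ, M.f x

/-- `c'`, one-sided at the end points of the quality interval. -/
def c' (q : ℝ) : ℝ := derivWithin M.c M.qualities q

/-- `c''`. -/
def c'' (q : ℝ) : ℝ := derivWithin M.c' M.qualities q

/-- `v_q`. -/
def vq (q θ : ℝ) : ℝ := derivWithin (fun x => M.v x θ) M.qualities q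

/-- `v_qq`. -/
def vqq (q θ : ℝ) : ℝ := derivWithin (fun x => M.vq x θ) M.qualities q

/-- Quality chosen under full revelation: the inverse of the marginal cost. -/
def qf (θ : ℝ) : ℝ := Function.invFunOn M.c' M.qualities θ

/-- Quality that is indifferent to the outside option: the inverse of the average cost
`c q / q` (whose value at `q = 0` is its limit, `0`). -/
def qi (θ : ℝ) : ℝ := Function.invFunOn (fun q => M.c q / q) M.qualities θ

/-- The type that would choose `qi θ₀` under full revelation. -/
def typeC (θ₀ : ℝ) : ℝ := M.c' (M.qi θ₀)

/-- Start of the fully revealing region: the median of `typeC θ₀`, `lo` and `hi`. -/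
def typeL (θ₀ : ℝ) : ℝ := max (min (M.typeC θ₀) M.hi) M.lo

/-! ### Ratings, equilibria, optimality -/

/-- The set of equilibrium qualities of those types that take the test and obtain score `s`. -/
def chosen {S : Type*} (π : ℝ → S) (q : ℝ → ℝ) (P : Set ℝ) (s : S) : Set ℝ :=
  {x | ∃ θ ∈ M.types, θ ∈ P ∧ π (q θ) = s ∧ q θ = x}

/-- Equilibrium under the deterministic rating `π`: type `θ` chooses quality `q θ`,
takes the test iff `θ ∈ P`, and the market pays `ω s` after score `s` and `0` to an agent who
does not take the test (such an agent has no reason to choose a positive quality).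
The payoff of type `θ` from wage `w` and quality `x` is `w - c x / θ`, written as `θ * w - c x`.
The wage is the mean of a belief that is supported, on path, on the qualities chosen by the
types that obtain the score, and off path on the qualities that the rating maps to the score. -/
structure IsEquilibrium {S : Type*} (π : ℝ → S) (q : ℝ → ℝ) (P : Set ℝ) (ω : S → ℝ) :
    Prop where
  quality_mem : ∀ θ ∈ M.types, q θ ∈ M.qualities
  test_optimal : ∀ θ ∈ M.types, θ ∈ P →
    0 ≤ θ * ω (π (q θ)) - M.c (q θ) ∧
      ∀ x ∈ M.qualities, θ * ω (π x) - M.c x ≤ θ * ω (π (q θ)) - M.c (q θ)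
  out_optimal : ∀ θ ∈ M.types, θ ∉ P →
    q θ = 0 ∧ ∀ x ∈ M.qualities, θ * ω (π x) - M.c x ≤ 0
  belief_on_path : ∀ s, (M.chosen π q P s).Nonempty → ω s ∈ convexHull ℝ (M.chosen π q P s)
  belief_off_path : ∀ s ∈ π '' M.qualities, ¬ (M.chosen π q P s).Nonempty →
    ω s ∈ convexHull ℝ {x ∈ M.qualities | π x = s}

/-- The quality scheme `q` is implementable by the deterministic rating `π`. -/
def Implements {S : Type*} (π : ℝ → S) (q : ℝ → ℝ) : Prop :=
  ∃ (P : Set ℝ) (ω : S → ℝ), M.IsEquilibrium π q P ω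

/-- The principal's expected payoff from the quality scheme `q`. -/
def payoff (q : ℝ → ℝ) : ℝ := ∫ θ in M.lo..M.hi, M.v (q θ) θ * M.f θ

/-- The rating `π`, inducing the quality scheme `q`, is optimal among all deterministic
ratings (with any set of scores). -/
def IsOptimal {S : Type*} (π : ℝ → S) (q : ℝ → ℝ) : Prop :=
  M.Implements π q ∧
    ∀ (S' : Type) (π' : ℝ → S') (q' : ℝ → ℝ), M.Implements π' q' → M.payoff q' ≤ M.payoff q

end RatingModel

/-- Lower censorship with minimum standard `q₀`; the score `none` is a fail. -/
def lowerCensorship (q₀ q : ℝ) : Option ℝ := open Classical in if q₀ ≤ q then some q else none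

/-- The pass/fail test with minimum standard `q₀`; the score `true` is a pass. -/
def passFail (q₀ q : ℝ) : Bool := open Classical in if q₀ ≤ q then true else false

/-- The fully revealing test. -/
def fullyRevealing (q : ℝ) : ℝ := q

namespace RatingModel

variable (M : RatingModel)

/-- The quality scheme of lower censorship with cutoff type `θ₀`: exclusion, bunching at
`qi θ₀`, full revelation. -/
def lcScheme (θ₀ θ : ℝ) : ℝ :=
  open Classical in if θ < θ₀ then 0 else if θ < M.typeC θ₀ then M.qi θ₀ else M.qf θ

/-- The quality scheme of the pass/fail test with cutoff type `θ₀`. -/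
def pfScheme (θ₀ θ : ℝ) : ℝ := open Classical in if θ < θ₀ then 0 else M.qi θ₀

/-- No type is excluded: every type chooses a positive quality (type `0`, for which every
positive quality is infinitely costly, is left out). -/
def NoExclusion (q : ℝ → ℝ) : Prop := ∀ θ ∈ M.types, 0 < θ → 0 < q θ

/-! ### The characteristic function and the conditions -/

/-- Relative concavity of the preferences of the principal and the agent. The infimum is over
`q > 0`; where `c''` is positive at `0`, the value `q = 0` does not change it by continuity. -/
def kappa : ℝ :=
  sInf {x | ∃ q ∈ Ioc 0 M.qmax, ∃ θ ∈ M.types, x = -M.vqq q θ / M.c'' q}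

/-- `r(θ|q)` for the cutoff `θ₀`. -/
def rAt (θ₀ θ q : ℝ) : ℝ :=
  M.vq q θ * M.f θ - M.kappa * (θ - M.c' q) * M.f θ - M.kappa * (M.F θ - M.F θ₀)

/-- The characteristic function for the cutoff `θ₀`: `r(θ|q)` at the quality that lower
censorship with cutoff `θ₀` induces. It equals `κ F(θ₀)` below `lo` and
`-κ (1 - F(θ₀))` above `hi`, as `f` vanishes there. -/
def r (θ₀ θ : ℝ) : ℝ := M.rAt θ₀ θ (M.lcScheme θ₀ θ)

/-- The multiplier `A(θ₀)`: the mean of `r` between `θ₀` and `typeC θ₀`, and the right limit of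
`r` at `θ₀` if the two coincide (that is, at `θ₀ = 0`). -/
def A (θ₀ : ℝ) : ℝ :=
  open Classical in
  if M.typeC θ₀ = θ₀ then Function.rightLim (M.r θ₀) θ₀
  else (1 / (M.typeC θ₀ - θ₀)) * ∫ x in θ₀..M.typeC θ₀, M.r θ₀ x

/-- The subgradient condition (S) at `θ₀`. -/
def CondS (θ₀ : ℝ) : Prop :=
  0 < M.A θ₀ ∧
    ∀ θ ∈ Icc 0 (M.typeL θ₀), M.A θ₀ * (θ - θ₀) ≤ ∫ x in θ₀..θ, M.r θ₀ x

/-- The concavity condition (C) at `θ₀`. -/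
def CondC (θ₀ : ℝ) : Prop := AntitoneOn (M.r θ₀) (Ioc (M.typeL θ₀) M.hi)

/-- `r` is quasi-unimodal, with (S) and (C) satisfied at the cutoff `θ₀`. The cutoffs in
`[0, hi]` are those that belong to a minimum standard `qi θ₀` in the set of qualities. -/
def QuasiUnimodalAt (θ₀ : ℝ) : Prop := θ₀ ∈ Icc 0 M.hi ∧ M.CondS θ₀ ∧ M.CondC θ₀

/-- `r` is quasi-increasing, with (S) satisfied at the cutoff `θ₀`. -/
def QuasiIncreasingAt (θ₀ : ℝ) : Prop := θ₀ ∈ Icc 0 M.hi ∧ M.CondS θ₀ ∧ M.hi ≤ M.typeC θ₀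

/-- `r` is quasi-decreasing, with (S) and (C) satisfied at the cutoff `θ₀`. -/
def QuasiDecreasingAt (θ₀ : ℝ) : Prop :=
  θ₀ ∈ Icc 0 M.hi ∧ M.CondS θ₀ ∧ M.CondC θ₀ ∧ θ₀ ≤ M.lo

end RatingModel

end

noncomputable section

/-! Types with the same score earn the same wage, so each can imitate the other; as `c` is strictly
increasing they choose the same quality, and the wage equals it (`IsEquilibrium.wage_eq`). Every
equilibrium scheme `s` is therefore incentive compatible for the payoff `θ * q - c q`. Its utility
`U_s` has subgradient `s`, so `s` is monotone and integrates to differences of `U_s`. The scheme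
extends to all types in `[0, ∞)`, with `U_s 0 = 0`.

Let `t` be the lower censorship scheme, `C = typeC θ₀` and `Δ = U_s - U_t`. By the choice of `κ`, `v
+ κ c` is concave in quality. Its tangent at `t`, integrated against `f` and then by parts, bounds
the gain from `s` by `∫ r (s - t) + κ (1 - F θ₀) Δ(T)` on `[0, T]`, `T = max hi C`
(`payoff_sub_le`).

Below `C`, (S) bounds the tail integrals of `r` by those of the constant `A`. A second mean value
inequality for the monotone `s` gives `∫ r (s - t) ≤ A Δ(C)` (`integral_r_mul_le_below`). Above `C`,
`A - r` is nonnegative and increasing, and `Δ ≤ 0` because `t` is the agent's unconstrained optimum.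
The same inequality gives `∫ r (s - t) ≤ r(hi) Δ(hi) - A Δ(C)` (`integral_r_mul_le_above`). If `C <
hi`, the sum leaves `(r(hi) + κ (1 - F θ₀)) Δ(hi)`, which is nonpositive by downward bias. If `hi ≤
C`, the part below suffices, since `A ≥ 0`. -/

/-! ### Functions with a subgradient at every point of an interval. -/

lemma sub_le_deriv_mul_of_antitoneOn {f f' : ℝ → ℝ} {a b : ℝ}
    (hd : ∀ x ∈ Icc a b, HasDerivWithinAt f (f' x) (Icc a b) x) (hm : AntitoneOn f' (Icc a b))
    {x y : ℝ} (hx : x ∈ Icc a b) (hy : y ∈ Icc a b) : f y - f x ≤ f' x * (y - x) := by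
  have mvt : ∀ u ∈ Icc a b, ∀ w ∈ Icc a b, u < w →
      ∃ z ∈ Ioo u w, f' z = (f w - f u) / (w - u) := by
    intro u hu w hw huw
    have hsub : Icc u w ⊆ Icc a b := Icc_subset_Icc hu.1 hw.2
    refine exists_hasDerivAt_eq_slope f f' huw
      (fun z hz => ((hd z (hsub hz)).continuousWithinAt).mono hsub) fun z hz => ?_
    exact (hd z (hsub (Ioo_subset_Icc_self hz))).hasDerivAt
      (Icc_mem_nhds (lt_of_le_of_lt hu.1 hz.1) (lt_of_lt_of_le hz.2 hw.2))
  rcases lt_trichotomy x y with h | h | h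
  · obtain ⟨z, hz, e⟩ := mvt x hx y hy h
    have h1 : f' z ≤ f' x := hm hx ⟨hx.1.trans hz.1.le, hz.2.le.trans hy.2⟩ hz.1.le
    rw [eq_div_iff (by linarith)] at e
    rw [← e]
    exact mul_le_mul_of_nonneg_right h1 (by linarith)
  · simp [h]
  · obtain ⟨z, hz, e⟩ := mvt y hy x hx h
    have h1 : f' x ≤ f' z := hm ⟨hy.1.trans hz.1.le, hz.2.le.trans hx.2⟩ hx hz.2.le
    rw [eq_div_iff (by linarith)] at e
    nlinarith [mul_le_mul_of_nonneg_right h1 (by linarith : 0 ≤ x - y)]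

lemma monotoneOn_of_subgradient {U q : ℝ → ℝ} {a b : ℝ}
    (h : ∀ x ∈ Icc a b, ∀ y ∈ Icc a b, U x + q x * (y - x) ≤ U y) :
    MonotoneOn q (Icc a b) := by
  intro x hx y hy hxy
  rcases hxy.eq_or_lt with rfl | hlt
  · rfl
  · have h1 := h x hx y hy
    have h2 := h y hy x hx
    by_contra hc
    push Not at hc
    nlinarith

lemma continuousOn_of_subgradient {U q : ℝ → ℝ} {a b : ℝ}
    (h : ∀ x ∈ Icc a b, ∀ y ∈ Icc a b, U x + q x * (y - x) ≤ U y) :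
    ContinuousOn U (Icc a b) := by
  have hm := monotoneOn_of_subgradient h
  have key : ∀ x ∈ Icc a b, ∀ y ∈ Icc a b, U y - U x ≤ (|q a| + |q b|) * |y - x| := by
    intro x hx y hy
    have hab : a ≤ b := hx.1.trans hx.2
    have h1 := h y hy x hx
    have h2 : q a ≤ q y := hm ⟨le_rfl, hab⟩ hy hy.1
    have h3 : q y ≤ q b := hm hy ⟨hab, le_rfl⟩ hy.2
    have h4 : |q y| ≤ |q a| + |q b| := by
      rw [abs_le]
      constructor
      · linarith [neg_abs_le (q a), abs_nonneg (q b)]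
      · linarith [le_abs_self (q b), abs_nonneg (q a)]
    calc U y - U x ≤ q y * (y - x) := by linarith
      _ ≤ |q y| * |y - x| := by rw [← abs_mul]; exact le_abs_self _
      _ ≤ _ := mul_le_mul_of_nonneg_right h4 (abs_nonneg _)
  have hK : 0 ≤ |q a| + |q b| := by positivity
  refine (LipschitzOnWith.of_dist_le_mul (K := ⟨_, hK⟩) fun x hx y hy => ?_).continuousOn
  rw [Real.dist_eq, Real.dist_eq, abs_le]
  have h1 := key x hx y hy
  have h2 := key y hy x hx
  rw [abs_sub_comm] at h1
  constructor
  · change -((|q a| + |q b|) * |x - y|) ≤ _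
    linarith
  · exact h2

/-- The two subgradient inequalities squeeze the remainder `U y - U x - q x * (y - x)` between `0`
and `(q y - q x) * (y - x)`, so continuity of `q` at `x` suffices, and a monotone `q` is
discontinuous only countably often. -/
lemma exists_countable_hasDerivAt_of_subgradient {U q : ℝ → ℝ} {a b : ℝ}
    (h : ∀ x ∈ Icc a b, ∀ y ∈ Icc a b, U x + q x * (y - x) ≤ U y) :
    ∃ S : Set ℝ, S.Countable ∧ ∀ x ∈ Ioo a b \ S, HasDerivAt U (q x) x := by
  have hm := monotoneOn_of_subgradient h
  refine ⟨_, hm.countable_not_continuousWithinAt, fun x hx => ?_⟩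
  obtain ⟨hx, hS⟩ := hx
  have hxI : x ∈ Icc a b := Ioo_subset_Icc_self hx
  have hc : ContinuousWithinAt q (Icc a b) x := by
    by_contra hc
    exact hS ⟨hxI, hc⟩
  have hc' : ContinuousAt q x := hc.continuousAt (Icc_mem_nhds hx.1 hx.2)
  rw [hasDerivAt_iff_isLittleO, Asymptotics.isLittleO_iff]
  intro ε hε
  filter_upwards [Icc_mem_nhds hx.1 hx.2, Metric.continuousAt_iff'.1 hc' ε hε] with y hy hq
  rw [Real.dist_eq] at hq
  have h1 := h x hxI y hy
  have h2 := h y hy x hxI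
  have h3 : 0 ≤ U y - U x - (y - x) • q x := by rw [smul_eq_mul]; linarith
  rw [Real.norm_eq_abs, Real.norm_eq_abs, abs_of_nonneg h3]
  calc U y - U x - (y - x) • q x ≤ (q y - q x) * (y - x) := by rw [smul_eq_mul]; linarith
    _ ≤ |q y - q x| * |y - x| := by rw [← abs_mul]; exact le_abs_self _
    _ ≤ _ := mul_le_mul_of_nonneg_right hq.le (abs_nonneg _)

lemma integral_eq_of_subgradient {U q : ℝ → ℝ} {a b : ℝ} (hab : a ≤ b)
    (h : ∀ x ∈ Icc a b, ∀ y ∈ Icc a b, U x + q x * (y - x) ≤ U y) :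
    ∫ x in a..b, q x = U b - U a := by
  obtain ⟨S, hS, hd⟩ := exists_countable_hasDerivAt_of_subgradient h
  refine integral_eq_of_hasDerivAt_off_countable_of_le U q hab hS (continuousOn_of_subgradient h)
    hd ?_
  have := monotoneOn_of_subgradient h
  rw [← uIcc_of_le hab] at this
  exact this.intervalIntegrable

/-! ### A second mean value inequality. -/

lemma exists_Ioc_ae_eq_of_upper {a b : ℝ} (hab : a ≤ b) {S : Set ℝ} (hS : S ⊆ Ioc a b)
    (hu : ∀ x ∈ S, ∀ y ∈ Ioc a b, x ≤ y → y ∈ S) :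
    ∃ x ∈ Icc a b, S =ᵐ[volume] Ioc x b := by
  rcases S.eq_empty_or_nonempty with rfl | hne
  · exact ⟨b, ⟨hab, le_rfl⟩, by simp⟩
  have hbd : BddBelow S := ⟨a, fun x hx => (hS hx).1.le⟩
  obtain ⟨z, hz⟩ := hne
  have hle : sInf S ≤ b := (csInf_le hbd hz).trans (hS hz).2
  have hge : a ≤ sInf S := le_csInf ⟨z, hz⟩ fun x hx => (hS hx).1.le
  refine ⟨sInf S, ⟨hge, hle⟩, ?_⟩
  refine Filter.EventuallyLE.antisymm ?_ ?_
  · have : S ⊆ Icc (sInf S) b := fun x hx => ⟨csInf_le hbd hx, (hS hx).2⟩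
    exact this.eventuallyLE.trans Ioc_ae_eq_Icc.symm.le
  · refine Filter.Eventually.of_forall fun y (hy : y ∈ Ioc (sInf S) b) => ?_
    obtain ⟨x, hx, hxy⟩ := exists_lt_of_csInf_lt ⟨z, hz⟩ hy.1
    exact hu x hx y ⟨hge.trans_lt hy.1, hy.2⟩ hxy.le

/-- A form of the second mean value theorem. -/
lemma integral_mul_le_of_monotone {a b K C : ℝ} {g h : ℝ → ℝ} (hab : a ≤ b) (hK : 0 ≤ K)
    (hg : Monotone g) (hg0 : ∀ x ∈ Ioc a b, 0 ≤ g x) (hgK : ∀ x ∈ Ioc a b, g x ≤ K)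
    (hh : IntervalIntegrable h volume a b) (hC : ∀ x ∈ Icc a b, ∫ y in x..b, h y ≤ C) :
    ∫ x in a..b, g x * h x ≤ K * C := by
  have hhi : IntegrableOn h (Ioc a b) := (intervalIntegrable_iff_integrableOn_Ioc_of_le hab).1 hh
  have hmeas : MeasurableSet {p : ℝ × ℝ | p.2 < g p.1} :=
    measurableSet_lt measurable_snd (hg.measurable.comp measurable_fst)
  -- Layer-cake decomposition: `g x` is the length of `{t ∈ (0, K] | t < g x}`. After Fubini, each
  -- level `t` integrates `h` over a superlevel set of `g`, which is a right tail of the interval up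
  -- to a null set.
  set H : ℝ → ℝ → ℝ := fun x t => ({p : ℝ × ℝ | p.2 < g p.1}).indicator (fun p => h p.1) (x, t)
    with hH
  have hint : Integrable (Function.uncurry H)
      ((volume.restrict (Ioc a b)).prod (volume.restrict (Ioc 0 K))) := by
    have : Function.uncurry H =
        ({p : ℝ × ℝ | p.2 < g p.1}).indicator (fun p => h p.1) := by
      ext ⟨x, t⟩; rfl
    rw [this]
    exact (hhi.comp_fst _).indicator hmeas
  have h1 : ∫ x in a..b, g x * h x = ∫ x in Ioc a b, ∫ t in Ioc 0 K, H x t := by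
    rw [intervalIntegral.integral_of_le hab]
    refine setIntegral_congr_fun measurableSet_Ioc fun x hx => ?_
    have e : ∀ t, H x t = (Iio (g x)).indicator (fun _ => h x) t := fun t => by
      simp [hH, indicator]
    simp only [e]
    rw [setIntegral_indicator measurableSet_Iio, setIntegral_const, smul_eq_mul]
    congr 1
    have : Ioc 0 K ∩ Iio (g x) = Ioo 0 (g x) := by
      ext t
      simp only [mem_inter_iff, mem_Ioc, mem_Iio, mem_Ioo]
      constructor
      · rintro ⟨⟨u, -⟩, w⟩; exact ⟨u, w⟩
      · rintro ⟨u, w⟩; exact ⟨⟨u, w.le.trans (hgK x hx)⟩, w⟩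
    rw [this, Real.volume_real_Ioo_of_le (hg0 x hx), sub_zero]
  rw [h1, integral_integral_swap hint]
  have h2 : ∀ t ∈ Ioc 0 K, ∫ x in Ioc a b, H x t ≤ C := by
    intro t _
    have e : ∀ x, H x t = ({x | t < g x}).indicator h x := fun x => by
      simp [hH, indicator]
    simp only [e]
    rw [setIntegral_indicator (measurableSet_lt measurable_const hg.measurable)]
    obtain ⟨x, hx, hxe⟩ := exists_Ioc_ae_eq_of_upper hab
      (S := Ioc a b ∩ {x | t < g x}) inter_subset_left
      (fun x hx y hy hxy => ⟨hy, lt_of_lt_of_le hx.2 (hg hxy)⟩)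
    rw [setIntegral_congr_set hxe, ← intervalIntegral.integral_of_le hx.2]
    exact hC x hx
  calc ∫ t in Ioc 0 K, ∫ x in Ioc a b, H x t ≤ ∫ t in Ioc 0 K, C := by
        refine setIntegral_mono_on hint.integral_prod_right (by simp) measurableSet_Ioc h2
    _ = K * C := by simp [hK]

lemma integral_mul_le_of_monotoneOn {a b K C : ℝ} {g h : ℝ → ℝ} (hab : a ≤ b) (hK : 0 ≤ K)
    (hg : MonotoneOn g (Ioc a b)) (hg0 : ∀ x ∈ Ioc a b, 0 ≤ g x) (hgK : ∀ x ∈ Ioc a b, g x ≤ K)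
    (hh : IntervalIntegrable h volume a b) (hC : ∀ x ∈ Icc a b, ∫ y in x..b, h y ≤ C) :
    ∫ x in a..b, g x * h x ≤ K * C := by
  classical
  -- The bounds `0 ≤ g ≤ K` make this extension monotone on the whole line.
  set G : ℝ → ℝ := fun x => if x ≤ a then 0 else if x ≤ b then g x else K with hG
  have hGe : ∀ x ∈ Ioc a b, G x = g x := fun x hx => by
    simp [hG, not_le.2 hx.1, hx.2]
  have hGm : Monotone G := by
    intro x y hxy
    simp only [hG]
    split_ifs with h1 h2 h3 h4 h5 h6 h7
    · rfl
    · exact hg0 y ⟨not_le.1 h2, h3⟩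
    · exact hK
    · linarith
    · exact hg ⟨not_le.1 h1, h4⟩ ⟨not_le.1 h5, h6⟩ hxy
    · exact hgK x ⟨not_le.1 h1, h4⟩
    · linarith
    · linarith
    · rfl
  have := integral_mul_le_of_monotone hab hK hGm (fun x hx => by rw [hGe x hx]; exact hg0 x hx)
    (fun x hx => by rw [hGe x hx]; exact hgK x hx) hh hC
  refine le_trans (le_of_eq ?_) this
  rw [intervalIntegral.integral_of_le hab, intervalIntegral.integral_of_le hab]
  exact setIntegral_congr_fun measurableSet_Ioc fun x hx => by simp only [hGe x hx]


/-! ### The cost function and the qualities `qf` and `qi`. -/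

namespace RatingModel

variable (M : RatingModel)

lemma hi_pos : 0 < M.hi := M.lo_nonneg.trans_lt M.lo_lt_hi

lemma zero_mem_qualities : 0 ∈ M.qualities := ⟨le_rfl, M.qmax_pos.le⟩

lemma qmax_mem_qualities : M.qmax ∈ M.qualities := ⟨M.qmax_pos.le, le_rfl⟩

lemma lo_mem_types : M.lo ∈ M.types := ⟨le_rfl, M.lo_lt_hi.le⟩

lemma hi_mem_types : M.hi ∈ M.types := ⟨M.lo_lt_hi.le, le_rfl⟩

lemma uniqueDiffOn_qualities : UniqueDiffOn ℝ M.qualities := uniqueDiffOn_Icc M.qmax_pos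

lemma hasDerivWithinAt_c {q : ℝ} (hq : q ∈ M.qualities) :
    HasDerivWithinAt M.c (M.c' q) M.qualities q :=
  ((M.c_smooth.differentiableOn (by norm_num)) q hq).hasDerivWithinAt

lemma contDiffOn_c' : ContDiffOn ℝ 1 M.c' M.qualities :=
  M.c_smooth.derivWithin M.uniqueDiffOn_qualities (by norm_num)

lemma continuousOn_c' : ContinuousOn M.c' M.qualities := M.contDiffOn_c'.continuousOn

lemma continuousOn_c : ContinuousOn M.c M.qualities := M.c_smooth.continuousOn

lemma hasDerivWithinAt_c' {q : ℝ} (hq : q ∈ M.qualities) :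
    HasDerivWithinAt M.c' (M.c'' q) M.qualities q :=
  ((M.contDiffOn_c'.differentiableOn (by norm_num)) q hq).hasDerivWithinAt

lemma c'_zero : M.c' 0 = 0 := M.c_deriv_zero

lemma c''_pos {q : ℝ} (hq : q ∈ Ioc 0 M.qmax) : 0 < M.c'' q := M.c_convex q hq

lemma strictMonoOn_c' : StrictMonoOn M.c' M.qualities := by
  refine strictMonoOn_of_deriv_pos (convex_Icc _ _) M.continuousOn_c' fun x hx => ?_
  rw [interior_Icc] at hx
  have hx' : x ∈ M.qualities := Ioo_subset_Icc_self hx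
  rw [((M.hasDerivWithinAt_c' hx').hasDerivAt (Icc_mem_nhds hx.1 hx.2)).deriv]
  exact M.c''_pos ⟨hx.1, hx.2.le⟩

lemma c'_nonneg {q : ℝ} (hq : q ∈ M.qualities) : 0 ≤ M.c' q := by
  rw [← M.c'_zero]
  exact M.strictMonoOn_c'.monotoneOn M.zero_mem_qualities hq hq.1

/-- A convex function lies above its tangents. -/
lemma c_tangent {x y : ℝ} (hx : x ∈ M.qualities) (hy : y ∈ M.qualities) :
    M.c x + M.c' x * (y - x) ≤ M.c y := by
  have := sub_le_deriv_mul_of_antitoneOn (f := fun q => -M.c q) (f' := fun q => -M.c' q)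
    (fun q hq => (M.hasDerivWithinAt_c hq).neg)
    (fun u hu w hw huw => neg_le_neg (M.strictMonoOn_c'.monotoneOn hu hw huw)) hx hy
  linarith

lemma strictMonoOn_c : StrictMonoOn M.c M.qualities := by
  refine strictMonoOn_of_deriv_pos (convex_Icc _ _) M.continuousOn_c fun x hx => ?_
  rw [interior_Icc] at hx
  have hx' : x ∈ M.qualities := Ioo_subset_Icc_self hx
  rw [((M.hasDerivWithinAt_c hx').hasDerivAt (Icc_mem_nhds hx.1 hx.2)).deriv, ← M.c'_zero]
  exact M.strictMonoOn_c' M.zero_mem_qualities hx' hx.1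

lemma c_nonneg {q : ℝ} (hq : q ∈ M.qualities) : 0 ≤ M.c q := by
  rw [← M.c_zero]
  exact M.strictMonoOn_c.monotoneOn M.zero_mem_qualities hq hq.1

lemma c_pos {q : ℝ} (hq : q ∈ M.qualities) (h : 0 < q) : 0 < M.c q := by
  rw [← M.c_zero]
  exact M.strictMonoOn_c M.zero_mem_qualities hq h

lemma c_lt_c'_mul {q : ℝ} (hq : q ∈ M.qualities) (h : 0 < q) : M.c q < M.c' q * q := by
  -- Passing through the midpoint turns two weak tangent inequalities into a strict one, since `c'`
  -- is strictly larger at `q` than at `q / 2`.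
  have hh : q / 2 ∈ M.qualities := ⟨by linarith, by linarith [hq.2]⟩
  have h1 := M.c_tangent hh M.zero_mem_qualities
  have h2 := M.c_tangent hq hh
  have h3 := M.strictMonoOn_c' hh hq (by linarith)
  rw [M.c_zero] at h1
  nlinarith

/-- The highest type that chooses a quality in the interior under full revelation. -/
def typeMax : ℝ := M.c' M.qmax

/-- At `qmax` the average cost is `hi`, and average cost lies below marginal cost. Hence every type
has a full-revelation quality in the feasible interval. -/
lemma hi_le_typeMax : M.hi ≤ M.typeMax := by
  have := M.c_lt_c'_mul M.qmax_mem_qualities M.qmax_pos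
  rw [M.c_qmax] at this
  exact (lt_of_mul_lt_mul_right this M.qmax_pos.le).le

lemma exists_c'_eq {θ : ℝ} (hθ : θ ∈ Icc 0 M.typeMax) : ∃ q ∈ M.qualities, M.c' q = θ := by
  have := intermediate_value_Icc M.qmax_pos.le M.continuousOn_c'
  rw [M.c'_zero] at this
  exact this hθ

lemma qf_mem {θ : ℝ} (hθ : θ ∈ Icc 0 M.typeMax) : M.qf θ ∈ M.qualities :=
  Function.invFunOn_mem (M.exists_c'_eq hθ)

lemma c'_qf {θ : ℝ} (hθ : θ ∈ Icc 0 M.typeMax) : M.c' (M.qf θ) = θ :=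
  Function.invFunOn_eq (M.exists_c'_eq hθ)

lemma qf_eq {θ q : ℝ} (hq : q ∈ M.qualities) (h : M.c' q = θ) : M.qf θ = q := by
  have hex : ∃ q ∈ M.qualities, M.c' q = θ := ⟨q, hq, h⟩
  exact M.strictMonoOn_c'.injOn (Function.invFunOn_mem hex) hq
    ((Function.invFunOn_eq hex).trans h.symm)

lemma strictMonoOn_qf : StrictMonoOn M.qf (Icc 0 M.typeMax) := by
  intro x hx y hy hxy
  rw [← M.strictMonoOn_c'.lt_iff_lt (M.qf_mem hx) (M.qf_mem hy), M.c'_qf hx, M.c'_qf hy]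
  exact hxy

lemma continuousOn_qf : ContinuousOn M.qf (Icc 0 M.typeMax) := by
  have hc : ∀ q ∈ M.qualities, M.c' q ∈ Icc 0 M.typeMax := fun q hq =>
    ⟨M.c'_nonneg hq, M.strictMonoOn_c'.monotoneOn hq M.qmax_mem_qualities hq.2⟩
  -- An order isomorphism between intervals is a homeomorphism, which gives continuity of the
  -- inverse.
  let e : Icc 0 M.typeMax ≃o M.qualities :=
    { toFun := fun θ => ⟨M.qf θ, M.qf_mem θ.2⟩
      invFun := fun q => ⟨M.c' q, hc q q.2⟩
      left_inv := fun θ => Subtype.ext (M.c'_qf θ.2)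
      right_inv := fun q => Subtype.ext (M.qf_eq q.2 rfl)
      map_rel_iff' := fun {a b} => M.strictMonoOn_qf.le_iff_le a.2 b.2 }
  have : OrdConnected M.qualities := ordConnected_Icc
  rw [continuousOn_iff_continuous_domRestrict]
  exact continuous_subtype_val.comp e.continuous

lemma continuousOn_average_cost : ContinuousOn (fun q => M.c q / q) M.qualities := by
  intro q hq
  rcases hq.1.eq_or_lt with rfl | hpos
  -- At `0` the convention `c 0 / 0 = 0` agrees with the limit of the average cost, the slope `c' 0
  -- = 0`.
  · have h := (hasDerivWithinAt_iff_tendsto_slope.1 (M.hasDerivWithinAt_c hq))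
    rw [M.c'_zero] at h
    rw [← continuousWithinAt_sdiff_self]
    simp only [ContinuousWithinAt, div_zero]
    refine h.congr fun x => ?_
    simp [slope_def_field, M.c_zero]
  · exact (M.continuousOn_c q hq).div continuousWithinAt_id hpos.ne'

lemma exists_average_cost_eq {θ : ℝ} (hθ : θ ∈ Icc 0 M.hi) :
    ∃ q ∈ M.qualities, M.c q / q = θ := by
  have := intermediate_value_Icc M.qmax_pos.le M.continuousOn_average_cost
  simp only [div_zero, M.c_qmax, mul_div_cancel_right₀ _ M.qmax_pos.ne'] at this
  exact this hθ

lemma qi_mem {θ : ℝ} (hθ : θ ∈ Icc 0 M.hi) : M.qi θ ∈ M.qualities :=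
  Function.invFunOn_mem (M.exists_average_cost_eq hθ)

lemma c_qi {θ : ℝ} (hθ : θ ∈ Icc 0 M.hi) : M.c (M.qi θ) = θ * M.qi θ := by
  have h : M.c (M.qi θ) / M.qi θ = θ := Function.invFunOn_eq (M.exists_average_cost_eq hθ)
  rcases (M.qi_mem hθ).1.eq_or_lt with h0 | h0
  · rw [← h0, M.c_zero, mul_zero]
  · rwa [div_eq_iff h0.ne'] at h

lemma qi_pos {θ : ℝ} (hθ : θ ∈ Icc 0 M.hi) (h : 0 < θ) : 0 < M.qi θ := by
  have e : M.c (M.qi θ) / M.qi θ = θ := Function.invFunOn_eq (M.exists_average_cost_eq hθ)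
  rcases (M.qi_mem hθ).1.eq_or_lt with h0 | h0
  · rw [← h0, div_zero] at e
    exact absurd e h.ne
  · exact h0

lemma qi_zero : M.qi 0 = 0 := by
  have h0 : (0 : ℝ) ∈ Icc 0 M.hi := ⟨le_rfl, M.hi_pos.le⟩
  by_contra h
  have h1 := M.c_pos (M.qi_mem h0) ((M.qi_mem h0).1.lt_of_ne' h)
  rw [M.c_qi h0] at h1
  simp at h1

lemma typeC_zero : M.typeC 0 = 0 := by rw [typeC, qi_zero, c'_zero]

lemma lt_typeC {θ : ℝ} (hθ : θ ∈ Icc 0 M.hi) (h : 0 < θ) : θ < M.typeC θ := by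
  have h1 := M.c_lt_c'_mul (M.qi_mem hθ) (M.qi_pos hθ h)
  rw [M.c_qi hθ] at h1
  exact lt_of_mul_lt_mul_right h1 (M.qi_mem hθ).1

lemma le_typeC {θ : ℝ} (hθ : θ ∈ Icc 0 M.hi) : θ ≤ M.typeC θ := by
  rcases hθ.1.eq_or_lt with rfl | h
  · rw [typeC_zero]
  · exact (M.lt_typeC hθ h).le

lemma typeC_le_typeMax {θ : ℝ} (hθ : θ ∈ Icc 0 M.hi) : M.typeC θ ≤ M.typeMax :=
  M.strictMonoOn_c'.monotoneOn (M.qi_mem hθ) M.qmax_mem_qualities (M.qi_mem hθ).2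

lemma qf_typeC {θ : ℝ} (hθ : θ ∈ Icc 0 M.hi) : M.qf (M.typeC θ) = M.qi θ :=
  M.qf_eq (M.qi_mem hθ) rfl

lemma qf_zero : M.qf 0 = 0 := M.qf_eq M.zero_mem_qualities M.c'_zero

lemma qf_optimal {θ d : ℝ} (hθ : θ ∈ Icc 0 M.typeMax) (hd : d ∈ M.qualities) :
    θ * d - M.c d ≤ θ * M.qf θ - M.c (M.qf θ) := by
  have h := M.c_tangent (M.qf_mem hθ) hd
  rw [M.c'_qf hθ] at h
  linarith

/-! ### The quality scheme of lower censorship -/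

lemma lcScheme_of_lt {θ₀ θ : ℝ} (h : θ < θ₀) : M.lcScheme θ₀ θ = 0 := by
  simp [lcScheme, h]

/-- Bunched types behave as type `typeC θ₀` does under full revelation. The single formula for both
regions yields continuity and the lower bound `qi θ₀`. -/
lemma lcScheme_of_ge {θ₀ θ : ℝ} (hθ₀ : θ₀ ∈ Icc 0 M.hi) (h : θ₀ ≤ θ) :
    M.lcScheme θ₀ θ = M.qf (max (M.typeC θ₀) θ) := by
  by_cases h' : θ < M.typeC θ₀
  · simp [lcScheme, not_lt.2 h, h', max_eq_left h'.le, M.qf_typeC hθ₀]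
  · simp [lcScheme, not_lt.2 h, h', max_eq_right (not_lt.1 h')]

lemma max_typeC_mem {θ₀ θ : ℝ} (hθ₀ : θ₀ ∈ Icc 0 M.hi) (h : θ ∈ Icc 0 M.typeMax) :
    max (M.typeC θ₀) θ ∈ Icc 0 M.typeMax :=
  ⟨h.1.trans (le_max_right _ _), max_le (M.typeC_le_typeMax hθ₀) h.2⟩

lemma lcScheme_mem {θ₀ θ : ℝ} (hθ₀ : θ₀ ∈ Icc 0 M.hi) (h : θ ∈ Icc 0 M.typeMax) :
    M.lcScheme θ₀ θ ∈ M.qualities := by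
  by_cases h' : θ < θ₀
  · rw [M.lcScheme_of_lt h']; exact M.zero_mem_qualities
  · rw [M.lcScheme_of_ge hθ₀ (not_lt.1 h')]
    exact M.qf_mem (M.max_typeC_mem hθ₀ h)

lemma qi_le_lcScheme {θ₀ θ : ℝ} (hθ₀ : θ₀ ∈ Icc 0 M.hi) (h : θ ∈ Icc 0 M.typeMax)
    (hle : θ₀ ≤ θ) : M.qi θ₀ ≤ M.lcScheme θ₀ θ := by
  rw [M.lcScheme_of_ge hθ₀ hle, ← M.qf_typeC hθ₀]
  exact M.strictMonoOn_qf.monotoneOn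
    ⟨hθ₀.1.trans (M.le_typeC hθ₀), M.typeC_le_typeMax hθ₀⟩ (M.max_typeC_mem hθ₀ h) (le_max_left _ _)

lemma lcScheme_optimal {θ₀ θ d : ℝ} (hθ₀ : θ₀ ∈ Icc 0 M.hi) (h : θ ∈ Icc 0 M.typeMax)
    (hd : d ∈ M.qualities) (hd0 : d = 0 ∨ M.qi θ₀ ≤ d) :
    θ * d - M.c d ≤ θ * M.lcScheme θ₀ θ - M.c (M.lcScheme θ₀ θ) := by
  -- The tangent at the standard has slope `typeC θ₀ ≥ θ₀`: qualities above the standard are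
  -- unprofitable for types below `θ₀`, and no better than the standard for bunched types.
  have ht : M.c (M.qi θ₀) + M.typeC θ₀ * (d - M.qi θ₀) ≤ M.c d := M.c_tangent (M.qi_mem hθ₀) hd
  have hqi := M.c_qi hθ₀
  have hC := M.le_typeC hθ₀
  have hq0 := (M.qi_mem hθ₀).1
  rcases lt_or_ge θ θ₀ with h1 | h1
  · rw [M.lcScheme_of_lt h1, M.c_zero]
    rcases hd0 with rfl | hd0
    · simp [M.c_zero]
    · nlinarith [hd.1]
  · rw [M.lcScheme_of_ge hθ₀ h1]
    rcases lt_or_ge θ (M.typeC θ₀) with h2 | h2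
    · rw [max_eq_left h2.le, M.qf_typeC hθ₀]
      rcases hd0 with rfl | hd0
      · simp only [M.c_zero]; nlinarith
      · nlinarith
    · rw [max_eq_right h2]
      exact M.qf_optimal h hd

lemma lcScheme_zero_of_nonneg {θ : ℝ} (h : 0 ≤ θ) : M.lcScheme 0 θ = M.qf θ := by
  rw [M.lcScheme_of_ge ⟨le_rfl, M.hi_pos.le⟩ h, typeC_zero, max_eq_right h]

end RatingModel

/-! ### Incentive compatible schemes and equilibria. -/

namespace RatingModel

variable (M : RatingModel)

/-- The payoff of type `θ` who chooses `s θ` and is paid the quality. -/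
def utility (s : ℝ → ℝ) (θ : ℝ) : ℝ := θ * s θ - M.c (s θ)

/-- Incentive compatibility and participation on the set `I` of types. -/
structure IsIC (I : Set ℝ) (s : ℝ → ℝ) : Prop where
  mem : ∀ θ ∈ I, s θ ∈ M.qualities
  optimal : ∀ θ ∈ I, ∀ t ∈ I, θ * s t - M.c (s t) ≤ M.utility s θ
  participation : ∀ θ ∈ I, 0 ≤ M.utility s θ

variable {M}

lemma IsIC.subset {I J : Set ℝ} {s : ℝ → ℝ} (h : M.IsIC I s) (hJ : J ⊆ I) : M.IsIC J s :=
  ⟨fun θ hθ => h.mem θ (hJ hθ), fun θ hθ t ht => h.optimal θ (hJ hθ) t (hJ ht),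
    fun θ hθ => h.participation θ (hJ hθ)⟩

lemma IsIC.subgradient {I : Set ℝ} {s : ℝ → ℝ} (h : M.IsIC I s) :
    ∀ x ∈ I, ∀ y ∈ I, M.utility s x + s x * (y - x) ≤ M.utility s y := by
  intro x hx y hy
  have := h.optimal y hy x hx
  rw [utility]
  linarith

lemma IsIC.monotoneOn {a b : ℝ} {s : ℝ → ℝ} (h : M.IsIC (Icc a b) s) : MonotoneOn s (Icc a b) :=
  monotoneOn_of_subgradient h.subgradient

lemma IsIC.utility_zero {I : Set ℝ} {s : ℝ → ℝ} (h : M.IsIC I s) (h0 : 0 ∈ I) :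
    M.utility s 0 = 0 := by
  refine le_antisymm ?_ (h.participation 0 h0)
  rw [utility]
  linarith [M.c_nonneg (h.mem 0 h0)]

lemma isIC_lcScheme {θ₀ : ℝ} (hθ₀ : θ₀ ∈ Icc 0 M.hi) :
    M.IsIC (Icc 0 M.typeMax) (M.lcScheme θ₀) where
  mem θ hθ := M.lcScheme_mem hθ₀ hθ
  optimal θ hθ t ht := by
    refine M.lcScheme_optimal hθ₀ hθ (M.lcScheme_mem hθ₀ ht) ?_
    rcases lt_or_ge t θ₀ with h | h
    · exact Or.inl (M.lcScheme_of_lt h)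
    · exact Or.inr (M.qi_le_lcScheme hθ₀ ht h)
  participation θ hθ := by
    have := M.lcScheme_optimal hθ₀ hθ M.zero_mem_qualities (Or.inl rfl)
    simpa [M.c_zero, utility] using this

/-- An incentive compatible scheme extends beyond the set of types by letting the other types
choose from the same menu. -/
lemma IsIC.exists_extension {s : ℝ → ℝ} (h : M.IsIC M.types s) :
    ∃ t : ℝ → ℝ, M.IsIC (Ici 0) t ∧ EqOn t s M.types := by
  classical
  have hmono : MonotoneOn s M.types := h.monotoneOn
  have hlo := M.lo_mem_types
  have hhi := M.hi_mem_types
  -- By single crossing and monotonicity of `s`, the best item of the menu for a type below `lo` is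
  -- `s lo` or quality `0`, and for a type above `hi` it is `s hi`.
  set t : ℝ → ℝ := fun x => if x < M.lo then (if x * s M.lo - M.c (s M.lo) ≤ 0 then 0 else s M.lo)
    else s (min x M.hi) with ht
  have hmin : ∀ x, M.lo ≤ x → min x M.hi ∈ M.types := fun x hx =>
    ⟨le_min hx M.lo_lt_hi.le, min_le_right _ _⟩
  have hrange : ∀ x, t x = 0 ∨ ∃ y ∈ M.types, t x = s y := by
    intro x
    simp only [ht]
    split_ifs with h1 h2
    · exact Or.inl rfl
    · exact Or.inr ⟨_, hlo, rfl⟩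
    · exact Or.inr ⟨_, hmin x (not_lt.1 h1), rfl⟩
  have hmem : ∀ x, t x ∈ M.qualities := by
    intro x
    rcases hrange x with e | ⟨y, hy, e⟩
    · rw [e]; exact M.zero_mem_qualities
    · rw [e]; exact h.mem y hy
  have hpart : ∀ x ∈ Ici (0 : ℝ), 0 ≤ M.utility t x := by
    intro x hx
    by_cases h1 : x < M.lo
    · by_cases h2 : x * s M.lo - M.c (s M.lo) ≤ 0
      · simp only [utility, ht, h1, h2, if_true, M.c_zero]; linarith
      · simp only [utility, ht, h1, h2, if_true, if_false]; linarith
    · simp only [utility, ht, h1, if_false]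
      have := h.participation _ (hmin x (not_lt.1 h1))
      rw [utility] at this
      have h3 := (h.mem _ (hmin x (not_lt.1 h1))).1
      nlinarith [min_le_left x M.hi]
  have hopt : ∀ x ∈ Ici (0 : ℝ), ∀ y ∈ M.types, x * s y - M.c (s y) ≤ M.utility t x := by
    intro x hx y hy
    by_cases h1 : x < M.lo
    · have h2 := h.optimal _ hlo y hy
      have h3 := hmono hlo hy hy.1
      rw [utility] at h2
      have h4 : x * s y - M.c (s y) ≤ x * s M.lo - M.c (s M.lo) := by nlinarith
      by_cases h5 : x * s M.lo - M.c (s M.lo) ≤ 0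
      · simp only [utility, ht, h1, h5, if_true, M.c_zero]; linarith
      · simp only [utility, ht, h1, h5, if_true, if_false]; linarith
    · simp only [utility, ht, h1, if_false]
      rcases le_total x M.hi with h2 | h2
      · have := h.optimal x ⟨not_lt.1 h1, h2⟩ y hy
        rw [utility] at this
        rwa [min_eq_left h2]
      · rw [min_eq_right h2]
        have h3 := h.optimal _ hhi y hy
        have h4 := hmono hy hhi hy.2
        rw [utility] at h3
        nlinarith
  refine ⟨t, ⟨fun x _ => hmem x, fun x hx y _ => ?_, hpart⟩, fun x hx => ?_⟩
  · rcases hrange y with e | ⟨z, hz, e⟩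
    · rw [e, M.c_zero]
      simpa using hpart x hx
    · rw [e]
      exact hopt x hx z hz
  · simp only [ht, not_lt.2 hx.1, if_false, min_eq_left hx.2]

/-- Under a deterministic rating, the market learns the quality in equilibrium. -/
lemma IsEquilibrium.wage_eq {S : Type*} {π : ℝ → S} {q : ℝ → ℝ} {P : Set ℝ} {ω : S → ℝ}
    (h : M.IsEquilibrium π q P ω) {θ : ℝ} (hθ : θ ∈ M.types) (hP : θ ∈ P) :
    ω (π (q θ)) = q θ := by
  have hch : M.chosen π q P (π (q θ)) = {q θ} := by
    ext x
    constructor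
    · rintro ⟨t, ht, htP, hs, rfl⟩
      -- Each type may imitate the other at an equal wage, so their costs coincide.
      have h1 := (h.test_optimal θ hθ hP).2 _ (h.quality_mem t ht)
      have h2 := (h.test_optimal t ht htP).2 _ (h.quality_mem θ hθ)
      rw [hs] at h1 h2
      exact M.strictMonoOn_c.injOn (h.quality_mem t ht) (h.quality_mem θ hθ) (by linarith)
    · rintro rfl
      exact ⟨θ, hθ, hP, rfl, rfl⟩
  have := h.belief_on_path (π (q θ)) (by rw [hch]; exact singleton_nonempty _)
  rw [hch, convexHull_singleton] at this
  exact this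

lemma IsEquilibrium.isIC {S : Type*} {π : ℝ → S} {q : ℝ → ℝ} {P : Set ℝ} {ω : S → ℝ}
    (h : M.IsEquilibrium π q P ω) : M.IsIC M.types q := by
  have hpart : ∀ θ ∈ M.types, 0 ≤ M.utility q θ := by
    intro θ hθ
    by_cases hP : θ ∈ P
    · have := (h.test_optimal θ hθ hP).1
      rwa [h.wage_eq hθ hP] at this
    · simp [utility, (h.out_optimal θ hθ hP).1, M.c_zero]
  refine ⟨h.quality_mem, fun θ hθ t ht => ?_, hpart⟩
  by_cases hP' : t ∈ P
  · by_cases hP : θ ∈ P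
    · have := (h.test_optimal θ hθ hP).2 _ (h.quality_mem t ht)
      rwa [h.wage_eq hθ hP, h.wage_eq ht hP'] at this
    · have := (h.out_optimal θ hθ hP).2 _ (h.quality_mem t ht)
      rw [h.wage_eq ht hP'] at this
      exact this.trans (hpart θ hθ)
  · rw [(h.out_optimal t ht hP').1, M.c_zero]
    simpa using hpart θ hθ

variable (M)

lemma types_subset : M.types ⊆ Icc 0 M.typeMax :=
  Icc_subset_Icc M.lo_nonneg M.hi_le_typeMax

lemma implements_lowerCensorship {θ₀ : ℝ} (hθ₀ : θ₀ ∈ Icc 0 M.hi) :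
    M.Implements (lowerCensorship (M.qi θ₀)) (M.lcScheme θ₀) := by
  have hs : ∀ x, M.qi θ₀ ≤ x → lowerCensorship (M.qi θ₀) x = some x := fun x hx => by
    simp [lowerCensorship, hx]
  have hn : ∀ x, x < M.qi θ₀ → lowerCensorship (M.qi θ₀) x = none := fun x hx => by
    simp [lowerCensorship, not_le.2 hx]
  have hself : ∀ θ ∈ M.types, θ ∈ Ici θ₀ →
      lowerCensorship (M.qi θ₀) (M.lcScheme θ₀ θ) = some (M.lcScheme θ₀ θ) := fun θ hθ h =>
    hs _ (M.qi_le_lcScheme hθ₀ (M.types_subset hθ) h)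
  have hdev : ∀ θ ∈ M.types, ∀ x ∈ M.qualities,
      θ * (lowerCensorship (M.qi θ₀) x).getD 0 - M.c x ≤ M.utility (M.lcScheme θ₀) θ := by
    intro θ hθ x hx
    rcases lt_or_ge x (M.qi θ₀) with h | h
    · rw [hn x h]
      have := (isIC_lcScheme hθ₀).participation θ (M.types_subset hθ)
      simp only [Option.getD_none, mul_zero]
      linarith [M.c_nonneg hx]
    · rw [hs x h]
      exact M.lcScheme_optimal hθ₀ (M.types_subset hθ) hx (Or.inr h)
  -- Excluded types opt out, so a fail is off path. The belief in quality `0` is then admissible: if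
  -- some feasible quality fails, so does `0`.
  refine ⟨Ici θ₀, fun o => o.getD 0, ⟨fun θ hθ => M.lcScheme_mem hθ₀ (M.types_subset hθ),
    fun θ hθ hP => ?_, fun θ hθ hP => ?_, fun o ho => ?_, fun o ho hne => ?_⟩⟩
  · simp only [hself θ hθ hP, Option.getD_some]
    exact ⟨(isIC_lcScheme hθ₀).participation θ (M.types_subset hθ), hdev θ hθ⟩
  · have e := M.lcScheme_of_lt (not_le.1 hP)
    refine ⟨e, fun x hx => (hdev θ hθ x hx).trans_eq ?_⟩
    simp [utility, e, M.c_zero]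
  · obtain ⟨x, hx⟩ := ho
    have hx' := hx
    obtain ⟨θ, hθ, hP, hπ, rfl⟩ := hx
    rw [hself θ hθ hP] at hπ
    subst hπ
    exact subset_convexHull ℝ _ hx'
  · obtain ⟨x, hx, rfl⟩ := ho
    rcases lt_or_ge x (M.qi θ₀) with h | h
    · refine subset_convexHull ℝ _ ⟨?_, ?_⟩
      · simpa [hn x h] using M.zero_mem_qualities
      · simp only [hn x h, Option.getD_none]
        exact hn 0 (hx.1.trans_lt h)
    · refine subset_convexHull ℝ _ ⟨?_, ?_⟩
      · simpa [hs x h] using hx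
      · simp [hs x h]

lemma implements_passFail {θ₀ : ℝ} (hθ₀ : θ₀ ∈ Icc 0 M.hi) :
    M.Implements (passFail (M.qi θ₀)) (M.pfScheme θ₀) := by
  have hs : ∀ x, M.qi θ₀ ≤ x → passFail (M.qi θ₀) x = true := fun x hx => by
    simp [passFail, hx]
  have hn : ∀ x, x < M.qi θ₀ → passFail (M.qi θ₀) x = false := fun x hx => by
    simp [passFail, not_le.2 hx]
  have hq := M.qi_mem hθ₀
  have hc := M.c_qi hθ₀
  have hlt : ∀ θ, θ < θ₀ → M.pfScheme θ₀ θ = 0 := fun θ h => by simp [pfScheme, h]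
  have hge : ∀ θ, θ₀ ≤ θ → M.pfScheme θ₀ θ = M.qi θ₀ := fun θ h => by
    simp [pfScheme, not_lt.2 h]
  have hdev : ∀ θ, ∀ x ∈ M.qualities,
      θ * (if passFail (M.qi θ₀) x then M.qi θ₀ else 0) - M.c x ≤
        max 0 (θ * M.qi θ₀ - M.c (M.qi θ₀)) := by
    intro θ x hx
    rcases lt_or_ge x (M.qi θ₀) with h | h
    · refine le_max_of_le_left ?_
      simp [hn x h, M.c_nonneg hx]
    · refine le_max_of_le_right ?_
      have := M.strictMonoOn_c.monotoneOn hq hx h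
      simp only [hs x h, if_true]
      linarith
  refine ⟨Ici θ₀, fun o => if o then M.qi θ₀ else 0, ⟨fun θ hθ => ?_,
    fun θ hθ hP => ?_, fun θ hθ hP => ?_, fun o ho => ?_, fun o ho hne => ?_⟩⟩
  · rcases lt_or_ge θ θ₀ with h | h
    · rw [hlt θ h]; exact M.zero_mem_qualities
    · rwa [hge θ h]
  · have h0 : 0 ≤ θ * M.qi θ₀ - M.c (M.qi θ₀) := by
      rw [hc, ← sub_mul]
      exact mul_nonneg (sub_nonneg.2 hP) hq.1
    have hd := hdev θ
    rw [max_eq_right h0] at hd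
    simp only [hge θ hP, hs _ le_rfl, if_true]
    exact ⟨h0, hd⟩
  · have h0 : θ * M.qi θ₀ - M.c (M.qi θ₀) ≤ 0 := by
      rw [hc, ← sub_mul]
      exact mul_nonpos_of_nonpos_of_nonneg (sub_nonpos.2 (not_le.1 hP).le) hq.1
    have hd := hdev θ
    rw [max_eq_left h0] at hd
    exact ⟨hlt θ (not_le.1 hP), hd⟩
  · obtain ⟨x, hx⟩ := ho
    have hx' := hx
    obtain ⟨θ, hθ, hP, hπ, rfl⟩ := hx
    rw [hge θ hP, hs _ le_rfl] at hπ
    subst hπ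
    rw [hge θ hP] at hx'
    exact subset_convexHull ℝ _ (by simpa using hx')
  · obtain ⟨x, hx, rfl⟩ := ho
    refine subset_convexHull ℝ _ ?_
    rcases lt_or_ge x (M.qi θ₀) with h | h
    · simp only [hn x h]
      exact ⟨by simpa using M.zero_mem_qualities, by simpa using hn 0 (hx.1.trans_lt h)⟩
    · simp only [hs x h, if_true]
      exact ⟨hq, hs _ le_rfl⟩

lemma implements_fullyRevealing : M.Implements fullyRevealing M.qf := by
  have hm : ∀ θ ∈ M.types, M.qf θ ∈ M.qualities := fun θ hθ => M.qf_mem (M.types_subset hθ)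
  refine ⟨univ, id, ⟨hm, fun θ hθ _ => ⟨?_, fun x hx => ?_⟩, fun θ _ h => absurd (mem_univ θ) h,
    fun s hs => ?_, fun s hs _ => ?_⟩⟩
  · have := M.qf_optimal (M.types_subset hθ) M.zero_mem_qualities
    simpa [M.c_zero, fullyRevealing] using this
  · exact M.qf_optimal (M.types_subset hθ) hx
  · obtain ⟨x, hx⟩ := hs
    have hx' := hx
    obtain ⟨θ, hθ, -, rfl, rfl⟩ := hx
    exact subset_convexHull ℝ _ hx'
  · obtain ⟨x, hx, rfl⟩ := hs
    exact subset_convexHull ℝ _ ⟨hx, rfl⟩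

end RatingModel

/-! ### The principal's utility, relative concavity and the distribution of types. -/

namespace RatingModel

variable (M : RatingModel)

lemma uniqueDiffOn_types : UniqueDiffOn ℝ M.types := uniqueDiffOn_Icc M.lo_lt_hi

lemma continuousOn_v : ContinuousOn (fun p : ℝ × ℝ => M.v p.1 p.2) (M.qualities ×ˢ M.types) :=
  M.v_smooth.continuousOn

lemma contDiffOn_v_slice {θ : ℝ} (hθ : θ ∈ M.types) :
    ContDiffOn ℝ 2 (fun q => M.v q θ) M.qualities :=
  M.v_smooth.comp (f := fun q : ℝ => (q, θ)) (contDiff_prodMk_left θ).contDiffOn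
    fun _ hq => ⟨hq, hθ⟩

lemma hasDerivWithinAt_v {q θ : ℝ} (hq : q ∈ M.qualities) (hθ : θ ∈ M.types) :
    HasDerivWithinAt (fun x => M.v x θ) (M.vq q θ) M.qualities q :=
  (((M.contDiffOn_v_slice hθ).differentiableOn (by norm_num)) q hq).hasDerivWithinAt

lemma contDiffOn_vq_slice {θ : ℝ} (hθ : θ ∈ M.types) :
    ContDiffOn ℝ 1 (fun q => M.vq q θ) M.qualities :=
  (M.contDiffOn_v_slice hθ).derivWithin M.uniqueDiffOn_qualities (by norm_num)

lemma hasDerivWithinAt_vq {q θ : ℝ} (hq : q ∈ M.qualities) (hθ : θ ∈ M.types) :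
    HasDerivWithinAt (fun x => M.vq x θ) (M.vqq q θ) M.qualities q :=
  (((M.contDiffOn_vq_slice hθ).differentiableOn (by norm_num)) q hq).hasDerivWithinAt

lemma continuousOn_vq :
    ContinuousOn (fun p : ℝ × ℝ => M.vq p.1 p.2) (M.qualities ×ˢ M.types) := by
  have hu : UniqueDiffOn ℝ (M.qualities ×ˢ M.types) :=
    M.uniqueDiffOn_qualities.prod M.uniqueDiffOn_types
  have h1 := M.v_smooth.continuousOn_fderivWithin hu (by norm_num)
  -- Joint continuity of `vq` comes from the total derivative evaluated in the direction `(1, 0)`.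
  have h2 : ContinuousOn (fun p : ℝ × ℝ => fderivWithin ℝ (fun p : ℝ × ℝ => M.v p.1 p.2)
      (M.qualities ×ˢ M.types) p (1, 0)) (M.qualities ×ˢ M.types) :=
    h1.clm_apply continuousOn_const
  refine h2.congr fun p hp => ?_
  obtain ⟨q, θ⟩ := p
  have hd := ((M.v_smooth.differentiableOn (by norm_num)) (q, θ) hp).hasFDerivWithinAt
  have hl : HasDerivWithinAt (fun x : ℝ => (x, θ)) ((1 : ℝ), (0 : ℝ)) M.qualities q :=
    (hasDerivWithinAt_id q _).prodMk (hasDerivWithinAt_const q _ θ)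
  have hc := hd.comp_hasDerivWithinAt q hl (t := M.qualities ×ˢ M.types)
    fun x hx => ⟨hx, hp.2⟩
  exact hc.derivWithin (M.uniqueDiffOn_qualities q hp.1)

lemma vqq_nonpos {q θ : ℝ} (hq : q ∈ M.qualities) (hθ : θ ∈ M.types) : M.vqq q θ ≤ 0 :=
  M.v_concave q hq θ hθ

lemma kappa_lower_bound : ∀ x ∈ {x | ∃ q ∈ Ioc 0 M.qmax, ∃ θ ∈ M.types,
    x = -M.vqq q θ / M.c'' q}, 0 ≤ x := by
  rintro x ⟨q, hq, θ, hθ, rfl⟩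
  have := M.vqq_nonpos (Ioc_subset_Icc_self hq) hθ
  exact div_nonneg (by linarith) (M.c''_pos hq).le

lemma kappa_nonneg : 0 ≤ M.kappa := Real.sInf_nonneg M.kappa_lower_bound

lemma kappa_mul_le {q θ : ℝ} (hq : q ∈ Ioc 0 M.qmax) (hθ : θ ∈ M.types) :
    M.kappa * M.c'' q ≤ -M.vqq q θ := by
  rw [← le_div_iff₀ (M.c''_pos hq)]
  exact csInf_le ⟨0, M.kappa_lower_bound⟩ ⟨q, hq, θ, hθ, rfl⟩

/-- The definition of `kappa` makes `vqq + kappa * c''` nonpositive for `q > 0`, so `v + kappa * c`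
is concave in quality. Only interior derivatives matter, so a vanishing `c'' 0` does no harm. -/
lemma antitoneOn_vq_add {θ : ℝ} (hθ : θ ∈ M.types) :
    AntitoneOn (fun q => M.vq q θ + M.kappa * M.c' q) M.qualities := by
  refine antitoneOn_of_deriv_nonpos (convex_Icc _ _)
    ((M.contDiffOn_vq_slice hθ).continuousOn.add (continuousOn_const.mul M.continuousOn_c'))
    (fun x hx => ?_) fun x hx => ?_
  all_goals
    rw [interior_Icc] at hx
    have hx' : x ∈ M.qualities := Ioo_subset_Icc_self hx
    have hd := ((M.hasDerivWithinAt_vq hx' hθ).add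
      ((M.hasDerivWithinAt_c' hx').const_mul M.kappa)).hasDerivAt (Icc_mem_nhds hx.1 hx.2)
  · exact hd.differentiableAt.differentiableWithinAt
  · have h1 := hd.deriv
    have h2 := M.kappa_mul_le ⟨hx.1, hx.2.le⟩ hθ
    have h3 : deriv (fun q => M.vq q θ + M.kappa * M.c' q) x
      = M.vqq x θ + M.kappa * M.c'' x := h1
    rw [h3]
    linarith

/-- The marginal value of quality to the principal, net of the weighted incentive of the agent. -/
def netMarginal (q θ : ℝ) : ℝ := M.vq q θ - M.kappa * (θ - M.c' q)

lemma continuousOn_netMarginal :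
    ContinuousOn (fun p : ℝ × ℝ => M.netMarginal p.1 p.2) (M.qualities ×ˢ M.types) := by
  refine M.continuousOn_vq.sub (continuousOn_const.mul (continuousOn_snd.sub ?_))
  exact M.continuousOn_c'.comp continuousOn_fst fun p hp => hp.1

/-- This is the tangent inequality for the concave function `v + kappa * c` at `t θ`, with the cost
difference expressed through the agent's utilities. -/
lemma v_sub_le {s t : ℝ → ℝ} {θ : ℝ} (hθ : θ ∈ M.types) (hs : s θ ∈ M.qualities)
    (ht : t θ ∈ M.qualities) :
    M.v (s θ) θ - M.v (t θ) θ ≤ M.netMarginal (t θ) θ * (s θ - t θ) +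
      M.kappa * (M.utility s θ - M.utility t θ) := by
  have h := sub_le_deriv_mul_of_antitoneOn (f := fun q => M.v q θ + M.kappa * M.c q)
    (fun q hq => (M.hasDerivWithinAt_v hq hθ).add ((M.hasDerivWithinAt_c hq).const_mul M.kappa))
    (M.antitoneOn_vq_add hθ) ht hs
  simp only [netMarginal, utility] at *
  linarith

/-! ### The distribution of types -/

lemma integrable_f : Integrable M.f := by
  by_contra h
  have := M.f_mass
  rw [integral_undef h] at this
  norm_num at this

lemma f_nonneg (θ : ℝ) : 0 ≤ M.f θ := by
  by_cases h : θ ∈ Icc M.lo M.hi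
  · exact (M.f_pos θ h).le
  · exact (M.f_zero θ h).ge

lemma F_of_le_lo {θ : ℝ} (h : θ ≤ M.lo) : M.F θ = 0 := by
  rw [F, integral_Iic_eq_integral_Iio]
  exact setIntegral_eq_zero_of_forall_eq_zero fun x hx =>
    M.f_zero x fun hx' => absurd hx'.1 (not_le.2 (lt_of_lt_of_le hx h))

lemma F_of_hi_le {θ : ℝ} (h : M.hi ≤ θ) : M.F θ = 1 := by
  rw [F, ← M.f_mass]
  refine setIntegral_eq_integral_of_forall_compl_eq_zero fun x hx => M.f_zero x fun hx' => ?_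
  exact hx (hx'.2.trans h)

lemma F_eq_add (a θ : ℝ) : M.F θ = M.F a + ∫ x in a..θ, M.f x := by
  rw [F, F, ← intervalIntegral.integral_Iic_sub_Iic M.integrable_f.integrableOn
    M.integrable_f.integrableOn]
  ring

lemma continuous_F : Continuous M.F := by
  have : M.F = fun θ => M.F 0 + ∫ x in (0 : ℝ)..θ, M.f x := funext fun θ => M.F_eq_add 0 θ
  rw [this]
  exact continuous_const.add (intervalIntegral.continuous_primitive
    (fun a b => M.integrable_f.intervalIntegrable) 0)

lemma F_le_one (θ : ℝ) : M.F θ ≤ 1 := by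
  rw [F, ← M.f_mass]
  exact setIntegral_le_integral M.integrable_f (Filter.Eventually.of_forall M.f_nonneg)

lemma continuousAt_f {θ : ℝ} (h : θ ≠ M.lo) (h' : θ ≠ M.hi) : ContinuousAt M.f θ := by
  by_cases hm : θ ∈ Icc M.lo M.hi
  · exact (M.f_cont θ hm).continuousAt
      (Icc_mem_nhds (hm.1.lt_of_ne' h) (hm.2.lt_of_ne h'))
  · have : M.f =ᶠ[nhds θ] fun _ => 0 := by
      filter_upwards [isClosed_Icc.isOpen_compl.mem_nhds hm] with x hx
      exact M.f_zero x hx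
    exact continuousAt_const.congr this.symm

lemma hasDerivAt_F {θ : ℝ} (h : θ ≠ M.lo) (h' : θ ≠ M.hi) : HasDerivAt M.F (M.f θ) θ := by
  have : M.F = fun θ => M.F 0 + ∫ x in (0 : ℝ)..θ, M.f x := funext fun θ => M.F_eq_add 0 θ
  rw [this]
  exact (intervalIntegral.integral_hasDerivAt_right M.integrable_f.intervalIntegrable
    (M.integrable_f.aestronglyMeasurable.stronglyMeasurableAtFilter)
    (M.continuousAt_f h h')).const_add _

lemma integrable_mul_f {g : ℝ × ℝ → ℝ} (hg : ContinuousOn g (M.qualities ×ˢ M.types))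
    {s : ℝ → ℝ} (hs : MonotoneOn s M.types) (hm : ∀ θ ∈ M.types, s θ ∈ M.qualities) :
    Integrable fun θ => g (s θ, θ) * M.f θ := by
  have hcomp : IsCompact (M.qualities ×ˢ M.types) := isCompact_Icc.prod isCompact_Icc
  obtain ⟨K, hK⟩ := hcomp.exists_bound_of_continuousOn hg
  have hmap : ∀ θ ∈ M.types, (s θ, θ) ∈ M.qualities ×ˢ M.types := fun θ hθ => ⟨hm θ hθ, hθ⟩
  have hmeas : AEStronglyMeasurable (fun θ => g (s θ, θ)) (volume.restrict M.types) := by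
    -- Clamping both coordinates to the rectangle makes `g ∘ e` continuous everywhere, so its
    -- composition with the monotone scheme is measurable.
    let e : ℝ × ℝ → ℝ × ℝ := fun p =>
      ((projIcc 0 M.qmax M.qmax_pos.le p.1 : ℝ), (projIcc M.lo M.hi M.lo_lt_hi.le p.2 : ℝ))
    have he : Continuous e := by
      refine Continuous.prodMk ?_ ?_
      · exact continuous_subtype_val.comp (continuous_projIcc.comp continuous_fst)
      · exact continuous_subtype_val.comp (continuous_projIcc.comp continuous_snd)
    have hge : Continuous fun p => g (e p) :=
      hg.comp_continuous he fun p => ⟨(projIcc 0 M.qmax M.qmax_pos.le _).2,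
        (projIcc M.lo M.hi M.lo_lt_hi.le _).2⟩
    have hsm : AEMeasurable (fun θ => (s θ, θ)) (volume.restrict M.types) :=
      (aemeasurable_restrict_of_monotoneOn measurableSet_Icc hs).prodMk aemeasurable_id
    refine (hge.measurable.comp_aemeasurable hsm).aestronglyMeasurable.congr ?_
    refine (ae_restrict_mem measurableSet_Icc).mono fun θ hθ => ?_
    have h1 := hmap θ hθ
    simp only [Function.comp, e, projIcc_of_mem _ h1.1, projIcc_of_mem _ h1.2]
  have hon : IntegrableOn (fun θ => g (s θ, θ) * M.f θ) M.types :=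
    M.integrable_f.integrableOn.bdd_mul hmeas
      ((ae_restrict_mem measurableSet_Icc).mono fun θ hθ => hK _ (hmap θ hθ))
  refine (integrableOn_iff_integrable_of_support_subset fun θ hθ => ?_).1 hon
  by_contra hc
  exact hθ (by simp [M.f_zero θ hc])

end RatingModel

/-! ### Bounds on the principal's gain from leaving lower censorship. -/

namespace RatingModel

variable {M : RatingModel}

lemma IsIC.integral_eq {T x y : ℝ} {s : ℝ → ℝ} (h : M.IsIC (Icc 0 T) s) (hx : 0 ≤ x)
    (hxy : x ≤ y) (hy : y ≤ T) : ∫ t in x..y, s t = M.utility s y - M.utility s x :=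
  integral_eq_of_subgradient hxy (h.subset (Icc_subset_Icc hx hy)).subgradient

lemma IsIC.intervalIntegrable_mul {a b : ℝ} {s g : ℝ → ℝ} (hab : a ≤ b)
    (h : M.IsIC (Icc a b) s) (hg : IntervalIntegrable g volume a b) :
    IntervalIntegrable (fun x => g x * s x) volume a b := by
  rw [intervalIntegrable_iff_integrableOn_Icc_of_le hab] at *
  refine Integrable.mul_bdd (c := M.qmax) hg
    (aemeasurable_restrict_of_monotoneOn measurableSet_Icc h.monotoneOn).aestronglyMeasurable
    ((ae_restrict_mem measurableSet_Icc).mono fun x hx => ?_)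
  rw [Real.norm_eq_abs, abs_of_nonneg (h.mem x hx).1]
  exact (h.mem x hx).2

lemma IsIC.intervalIntegrable {a b : ℝ} {s : ℝ → ℝ} (hab : a ≤ b)
    (h : M.IsIC (Icc a b) s) : IntervalIntegrable s volume a b := by
  simpa using h.intervalIntegrable_mul hab (g := fun _ => 1) intervalIntegrable_const

lemma IsIC.continuousOn_utility {a b : ℝ} {s : ℝ → ℝ} (h : M.IsIC (Icc a b) s) :
    ContinuousOn (M.utility s) (Icc a b) :=
  continuousOn_of_subgradient h.subgradient

/-- Integration by parts for the difference of two information rents against the distribution of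
types. -/
lemma IsIC.integral_by_parts {T : ℝ} {s t : ℝ → ℝ} (hT : 0 ≤ T) (hs : M.IsIC (Icc 0 T) s)
    (ht : M.IsIC (Icc 0 T) t) (k : ℝ) :
    ∫ x in (0 : ℝ)..T, ((s x - t x) * (M.F x - k) + (M.utility s x - M.utility t x) * M.f x) =
      (M.utility s T - M.utility t T) * (M.F T - k) := by
  obtain ⟨S₁, hS₁, hd₁⟩ := exists_countable_hasDerivAt_of_subgradient hs.subgradient
  obtain ⟨S₂, hS₂, hd₂⟩ := exists_countable_hasDerivAt_of_subgradient ht.subgradient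
  have h0 : (0 : ℝ) ∈ Icc 0 T := ⟨le_rfl, hT⟩
  have hc : ContinuousOn (fun x => M.utility s x - M.utility t x) (Icc 0 T) :=
    hs.continuousOn_utility.sub ht.continuousOn_utility
  have hF : ContinuousOn (fun x => M.F x - k) (Icc 0 T) :=
    (M.continuous_F.sub continuous_const).continuousOn
  have := integral_eq_of_hasDerivAt_off_countable_of_le
    (fun x => (M.utility s x - M.utility t x) * (M.F x - k))
    (fun x => (s x - t x) * (M.F x - k) + (M.utility s x - M.utility t x) * M.f x) hT
    -- The exceptional points are the kinks of the two utilities and the end points of the support,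
    -- where `f` may jump. The boundary term at `0` vanishes because both utilities do.
    (s := S₁ ∪ S₂ ∪ {M.lo, M.hi}) ((hS₁.union hS₂).union (by simp)) (hc.mul hF)
    (fun x hx => ?_) ?_
  · rw [this, hs.utility_zero h0, ht.utility_zero h0]
    ring
  · simp only [mem_sdiff, mem_union, mem_insert_iff, mem_singleton_iff, not_or] at hx
    obtain ⟨hx, ⟨h1, h2⟩, h3, h4⟩ := hx
    exact ((hd₁ x ⟨hx, h1⟩).sub (hd₂ x ⟨hx, h2⟩)).mul ((M.hasDerivAt_F h3 h4).sub_const k)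
  · rw [← uIcc_of_le hT] at hF hc
    exact (((hs.intervalIntegrable hT).sub (ht.intervalIntegrable hT)).mul_continuousOn hF).add
      (M.integrable_f.intervalIntegrable.continuousOn_mul hc)

variable (M)

lemma r_eq (θ₀ θ : ℝ) : M.r θ₀ θ =
    M.netMarginal (M.lcScheme θ₀ θ) θ * M.f θ - M.kappa * (M.F θ - M.F θ₀) := by
  simp only [r, rAt, netMarginal]
  ring

lemma intervalIntegrable_r {θ₀ : ℝ} (hθ₀ : θ₀ ∈ Icc 0 M.hi) (a b : ℝ) :
    IntervalIntegrable (M.r θ₀) volume a b := by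
  have hic := (isIC_lcScheme hθ₀).subset M.types_subset
  have h1 := M.integrable_mul_f M.continuousOn_netMarginal hic.monotoneOn hic.mem
  have h2 : Continuous fun θ => M.kappa * (M.F θ - M.F θ₀) :=
    continuous_const.mul (M.continuous_F.sub continuous_const)
  have : M.r θ₀ = fun θ =>
    M.netMarginal (M.lcScheme θ₀ θ) θ * M.f θ - M.kappa * (M.F θ - M.F θ₀) :=
    funext fun θ => M.r_eq θ₀ θ
  rw [this]
  exact h1.intervalIntegrable.sub (h2.intervalIntegrable a b)

lemma payoff_eq {T : ℝ} (hT : M.hi ≤ T) (s : ℝ → ℝ) :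
    M.payoff s = ∫ θ in (0 : ℝ)..T, M.v (s θ) θ * M.f θ := by
  rw [payoff, intervalIntegral.integral_of_le M.lo_lt_hi.le,
    intervalIntegral.integral_of_le (M.hi_pos.le.trans hT), ← integral_Icc_eq_integral_Ioc,
    ← integral_Icc_eq_integral_Ioc]
  refine (setIntegral_eq_of_subset_of_forall_sdiff_eq_zero measurableSet_Icc
    (Icc_subset_Icc M.lo_nonneg hT) fun x hx => ?_).symm
  rw [M.f_zero x hx.2, mul_zero]

lemma payoff_congr {s t : ℝ → ℝ} (h : EqOn s t M.types) : M.payoff s = M.payoff t := by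
  refine intervalIntegral.integral_congr fun x hx => ?_
  rw [uIcc_of_le M.lo_lt_hi.le] at hx
  simp only [h hx]

/-- The principal's gain from replacing lower censorship by another incentive compatible scheme
is bounded by a linear functional of the change in the scheme. -/
lemma payoff_sub_le {θ₀ T : ℝ} {s : ℝ → ℝ} (hθ₀ : θ₀ ∈ Icc 0 M.hi) (hT : M.hi ≤ T)
    (hT' : T ≤ M.typeMax) (hs : M.IsIC (Icc 0 T) s) :
    M.payoff s - M.payoff (M.lcScheme θ₀) ≤
      (∫ x in (0 : ℝ)..T, M.r θ₀ x * (s x - M.lcScheme θ₀ x)) + M.kappa * (1 - M.F θ₀) *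
        (M.utility s T - M.utility (M.lcScheme θ₀) T) := by
  have hT0 : 0 ≤ T := M.hi_pos.le.trans hT
  set t := M.lcScheme θ₀ with ht_def
  have ht : M.IsIC (Icc 0 T) t := (isIC_lcScheme hθ₀).subset (Icc_subset_Icc_right hT')
  have hsub : M.types ⊆ Icc 0 T := Icc_subset_Icc M.lo_nonneg hT
  have hvs := M.integrable_mul_f M.continuousOn_v (hs.subset hsub).monotoneOn (hs.subset hsub).mem
  have hvt := M.integrable_mul_f M.continuousOn_v (ht.subset hsub).monotoneOn (ht.subset hsub).mem
  have hr := M.intervalIntegrable_r hθ₀ 0 T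
  have hrw : IntervalIntegrable (fun x => M.r θ₀ x * (s x - t x)) volume 0 T := by
    simp only [mul_sub]
    exact (hs.intervalIntegrable_mul hT0 hr).sub (ht.intervalIntegrable_mul hT0 hr)
  have hc : ContinuousOn (fun x => M.utility s x - M.utility t x) (uIcc 0 T) := by
    rw [uIcc_of_le hT0]
    exact hs.continuousOn_utility.sub ht.continuousOn_utility
  have hp : IntervalIntegrable (fun x => (s x - t x) * (M.F x - M.F θ₀) +
      (M.utility s x - M.utility t x) * M.f x) volume 0 T :=
    (((hs.intervalIntegrable hT0).sub (ht.intervalIntegrable hT0)).mul_continuousOn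
      (M.continuous_F.sub continuous_const).continuousOn).add
      (M.integrable_f.intervalIntegrable.continuousOn_mul hc)
  have hparts := hs.integral_by_parts hT0 ht (M.F θ₀)
  rw [M.F_of_hi_le hT] at hparts
  rw [M.payoff_eq hT, M.payoff_eq hT, ← intervalIntegral.integral_sub hvs.intervalIntegrable
    hvt.intervalIntegrable]
  calc ∫ x in (0 : ℝ)..T, (M.v (s x) x * M.f x - M.v (t x) x * M.f x)
      ≤ ∫ x in (0 : ℝ)..T, (M.r θ₀ x * (s x - t x) + M.kappa * ((s x - t x) *
        (M.F x - M.F θ₀) + (M.utility s x - M.utility t x) * M.f x)) := by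
        refine intervalIntegral.integral_mono_on hT0
          (hvs.intervalIntegrable.sub hvt.intervalIntegrable) (hrw.add (hp.const_mul _))
          fun x hx => ?_
        rw [M.r_eq, ← ht_def]
        -- Off the support `f` vanishes and `r` reduces to `-kappa * (F - F θ₀)`, which cancels the
        -- by-parts term exactly.
        by_cases hxt : x ∈ M.types
        · have h1 := M.v_sub_le hxt (hs.mem x hx) (ht.mem x hx)
          nlinarith [M.f_nonneg x, mul_le_mul_of_nonneg_right h1 (M.f_nonneg x)]
        · rw [M.f_zero x hxt]
          apply le_of_eq
          ring
    _ = _ := by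
        rw [intervalIntegral.integral_add hrw (hp.const_mul _),
          intervalIntegral.integral_const_mul, hparts]
        ring

lemma utility_le_lcScheme {θ₀ x : ℝ} {s : ℝ → ℝ} (hθ₀ : θ₀ ∈ Icc 0 M.hi)
    (hx : M.typeC θ₀ ≤ x) (hx' : x ≤ M.typeMax) (hs : s x ∈ M.qualities) :
    M.utility s x ≤ M.utility (M.lcScheme θ₀) x := by
  have h0 := M.le_typeC hθ₀
  rw [utility, utility, M.lcScheme_of_ge hθ₀ (h0.trans hx), max_eq_right hx]
  exact M.qf_optimal ⟨hθ₀.1.trans (h0.trans hx), hx'⟩ hs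

/-- The tails of `r - A` up to `typeC θ₀` have nonpositive integral, so `r - A` integrates
nonpositively against the increasing `s`. Against the step function `lcScheme θ₀` it integrates to
zero by `hA`. The remaining constant `A` multiplies the integral of the change in quality, which is
the change in utility. -/
lemma integral_r_mul_le_below {θ₀ A : ℝ} {s : ℝ → ℝ} (hθ₀ : θ₀ ∈ Icc 0 M.hi)
    (hs : M.IsIC (Icc 0 (M.typeC θ₀)) s)
    (hA : ∫ x in θ₀..M.typeC θ₀, M.r θ₀ x = A * (M.typeC θ₀ - θ₀))
    (hle : ∀ x ∈ Icc 0 (M.typeC θ₀), ∫ y in x..M.typeC θ₀, M.r θ₀ y ≤ A * (M.typeC θ₀ - x)) :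
    ∫ x in (0 : ℝ)..M.typeC θ₀, M.r θ₀ x * (s x - M.lcScheme θ₀ x) ≤
      A * (M.utility s (M.typeC θ₀) - M.utility (M.lcScheme θ₀) (M.typeC θ₀)) := by
  set C := M.typeC θ₀ with hC
  set t := M.lcScheme θ₀ with ht_def
  have h0C : θ₀ ≤ C := M.le_typeC hθ₀
  have hC0 : 0 ≤ C := hθ₀.1.trans h0C
  have ht : M.IsIC (Icc 0 C) t :=
    (isIC_lcScheme hθ₀).subset (Icc_subset_Icc_right (M.typeC_le_typeMax hθ₀))
  have hr : ∀ a b, IntervalIntegrable (fun x => M.r θ₀ x - A) volume a b := fun a b =>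
    (M.intervalIntegrable_r hθ₀ a b).sub intervalIntegrable_const
  have hint : ∀ x, ∫ y in x..C, (M.r θ₀ y - A) = (∫ y in x..C, M.r θ₀ y) - A * (C - x) := by
    intro x
    rw [intervalIntegral.integral_sub (M.intervalIntegrable_r hθ₀ _ _) intervalIntegrable_const,
      intervalIntegral.integral_const, smul_eq_mul, mul_comm]
  have h1 : ∫ x in (0 : ℝ)..C, (M.r θ₀ x - A) * s x ≤ 0 := by
    have := integral_mul_le_of_monotoneOn hC0 M.qmax_pos.le
      (hs.monotoneOn.mono Ioc_subset_Icc_self)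
      (fun x hx => (hs.mem x (Ioc_subset_Icc_self hx)).1)
      (fun x hx => (hs.mem x (Ioc_subset_Icc_self hx)).2) (hr 0 C) (C := 0)
      (fun x hx => by rw [hint]; linarith [hle x hx])
    rw [mul_zero] at this
    simpa only [mul_comm] using this
  have h2 : ∫ x in (0 : ℝ)..C, (M.r θ₀ x - A) * t x = 0 := by
    have hi1 : IntervalIntegrable (fun x => (M.r θ₀ x - A) * t x) volume 0 θ₀ :=
      (ht.subset (Icc_subset_Icc_right h0C)).intervalIntegrable_mul hθ₀.1 (hr _ _)
    have hi2 : IntervalIntegrable (fun x => (M.r θ₀ x - A) * t x) volume θ₀ C :=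
      (ht.subset (Icc_subset_Icc_left hθ₀.1)).intervalIntegrable_mul h0C (hr _ _)
    rw [← intervalIntegral.integral_add_adjacent_intervals hi1 hi2]
    have e1 : ∫ x in (0 : ℝ)..θ₀, (M.r θ₀ x - A) * t x = ∫ x in (0 : ℝ)..θ₀, (0 : ℝ) := by
      refine intervalIntegral.integral_congr_ae ?_
      filter_upwards [compl_mem_ae_iff.2 (measure_singleton θ₀)] with x hx hx'
      rw [uIoc_of_le hθ₀.1] at hx'
      rw [ht_def, M.lcScheme_of_lt (hx'.2.lt_of_ne hx), mul_zero]
    have e2 : ∫ x in θ₀..C, (M.r θ₀ x - A) * t x =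
        ∫ x in θ₀..C, (M.r θ₀ x - A) * M.qi θ₀ := by
      refine intervalIntegral.integral_congr fun x hx => ?_
      rw [uIcc_of_le h0C] at hx
      simp only [ht_def]
      rw [M.lcScheme_of_ge hθ₀ hx.1, max_eq_left hx.2, M.qf_typeC hθ₀]
    rw [e1, e2, intervalIntegral.integral_zero, intervalIntegral.integral_mul_const, hint, hA]
    ring
  have hw : ∫ x in (0 : ℝ)..C, (s x - t x) = M.utility s C - M.utility t C := by
    rw [intervalIntegral.integral_sub (hs.intervalIntegrable hC0) (ht.intervalIntegrable hC0),
      hs.integral_eq le_rfl hC0 le_rfl, ht.integral_eq le_rfl hC0 le_rfl,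
      hs.utility_zero ⟨le_rfl, hC0⟩, ht.utility_zero ⟨le_rfl, hC0⟩]
    ring
  have e : (fun x => M.r θ₀ x * (s x - t x)) = fun x =>
      ((M.r θ₀ x - A) * s x - (M.r θ₀ x - A) * t x) + A * (s x - t x) := by
    ext x; ring
  have i1 := hs.intervalIntegrable_mul hC0 (hr 0 C)
  have i2 := ht.intervalIntegrable_mul hC0 (hr 0 C)
  rw [e, intervalIntegral.integral_add (i1.sub i2)
    (((hs.intervalIntegrable hC0).sub (ht.intervalIntegrable hC0)).const_mul A),
    intervalIntegral.integral_sub i1 i2, intervalIntegral.integral_const_mul, h2, hw]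
  linarith

/-- Here the monotone weight is `A - r` and the scheme difference is integrated: its tail integrals
are differences of `U_s - U_t`, bounded because `U_s ≤ U_t` above `typeC θ₀`. The term at `typeC θ₀`
is arranged to cancel the bound from below. -/
lemma integral_r_mul_le_above {θ₀ A : ℝ} {s : ℝ → ℝ} (hθ₀ : θ₀ ∈ Icc 0 M.hi)
    (hC : M.typeC θ₀ < M.hi) (hs : M.IsIC (Icc 0 M.hi) s)
    (hanti : AntitoneOn (M.r θ₀) (Ioc (M.typeC θ₀) M.hi))
    (hbd : ∀ x ∈ Ioc (M.typeC θ₀) M.hi, M.r θ₀ x ≤ A) :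
    ∫ x in M.typeC θ₀..M.hi, M.r θ₀ x * (s x - M.lcScheme θ₀ x) ≤
      M.r θ₀ M.hi * (M.utility s M.hi - M.utility (M.lcScheme θ₀) M.hi) -
      A * (M.utility s (M.typeC θ₀) - M.utility (M.lcScheme θ₀) (M.typeC θ₀)) := by
  set C := M.typeC θ₀ with hCdef
  set t := M.lcScheme θ₀ with ht_def
  have hC0 : 0 ≤ C := hθ₀.1.trans (M.le_typeC hθ₀)
  have ht : M.IsIC (Icc 0 M.hi) t :=
    (isIC_lcScheme hθ₀).subset (Icc_subset_Icc_right M.hi_le_typeMax)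
  have hsi : ∀ x ∈ Icc C M.hi, IntervalIntegrable s volume x M.hi := fun x hx =>
    (hs.subset (Icc_subset_Icc_left (hC0.trans hx.1))).intervalIntegrable hx.2
  have hti : ∀ x ∈ Icc C M.hi, IntervalIntegrable t volume x M.hi := fun x hx =>
    (ht.subset (Icc_subset_Icc_left (hC0.trans hx.1))).intervalIntegrable hx.2
  have hCm : C ∈ Icc C M.hi := ⟨le_rfl, hC.le⟩
  have hhi : M.hi ∈ Ioc C M.hi := ⟨hC, le_rfl⟩
  have hw : ∀ x ∈ Icc C M.hi, ∫ y in x..M.hi, (t y - s y) =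
      (M.utility s x - M.utility t x) - (M.utility s M.hi - M.utility t M.hi) := by
    intro x hx
    rw [intervalIntegral.integral_sub (hti x hx) (hsi x hx),
      ht.integral_eq (hC0.trans hx.1) hx.2 le_rfl, hs.integral_eq (hC0.trans hx.1) hx.2 le_rfl]
    ring
  have key := integral_mul_le_of_monotoneOn (g := fun x => A - M.r θ₀ x)
    (h := fun y => t y - s y) (K := A - M.r θ₀ M.hi)
    (C := -(M.utility s M.hi - M.utility t M.hi)) hC.le
    (sub_nonneg.2 (hbd _ hhi)) (fun x hx y hy hxy => sub_le_sub_left (hanti hx hy hxy) A)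
    (fun x hx => sub_nonneg.2 (hbd x hx))
    (fun x hx => sub_le_sub_left (hanti hx hhi hx.2) A)
    ((hti C hCm).sub (hsi C hCm)) (fun x hx => by
      rw [hw x hx]
      have := M.utility_le_lcScheme hθ₀ hx.1 (hx.2.trans M.hi_le_typeMax)
        (hs.mem x ⟨hC0.trans hx.1, hx.2⟩)
      linarith)
  have hr := M.intervalIntegrable_r hθ₀ C M.hi
  have i1 := (hs.subset (Icc_subset_Icc_left hC0)).intervalIntegrable_mul hC.le
    (intervalIntegrable_const.sub hr : IntervalIntegrable (fun x => A - M.r θ₀ x) volume C M.hi)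
  have i2 := (ht.subset (Icc_subset_Icc_left hC0)).intervalIntegrable_mul hC.le
    (intervalIntegrable_const.sub hr : IntervalIntegrable (fun x => A - M.r θ₀ x) volume C M.hi)
  have e : (fun x => M.r θ₀ x * (s x - t x)) = fun x =>
      (A - M.r θ₀ x) * (t x - s x) - A * (t x - s x) := by
    ext x; ring
  have i3 : IntervalIntegrable (fun x => (A - M.r θ₀ x) * (t x - s x)) volume C M.hi := by
    simp only [mul_sub]
    exact i2.sub i1
  rw [e, intervalIntegral.integral_sub i3 (((hti C hCm).sub (hsi C hCm)).const_mul A),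
    intervalIntegral.integral_const_mul, hw C hCm]
  linarith

/-- The highest type chooses `qf hi`, where the incentive term vanishes and downward bias makes `vq`
nonnegative. -/
lemma neg_kappa_le_r_hi {θ₀ : ℝ} (hθ₀ : θ₀ ∈ Icc 0 M.hi) (hC : M.typeC θ₀ < M.hi) :
    -(M.kappa * (1 - M.F θ₀)) ≤ M.r θ₀ M.hi := by
  have hhi : M.hi ∈ Icc 0 M.typeMax := ⟨M.hi_pos.le, M.hi_le_typeMax⟩
  have h1 := M.downward_bias M.hi M.hi_mem_types (M.qf M.hi) (M.qf_mem hhi) (M.c'_qf hhi)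
  have h2 : 0 ≤ M.vq (M.qf M.hi) M.hi := h1
  rw [r_eq, M.lcScheme_of_ge hθ₀ hθ₀.2, max_eq_right hC.le, M.F_of_hi_le le_rfl, netMarginal,
    M.c'_qf hhi, sub_self, mul_zero, sub_zero]
  have := mul_nonneg h2 (M.f_nonneg M.hi)
  linarith

/-- The multiplier is left free, and its sign matters only if `hi ≤ typeC θ₀`; otherwise it cancels
between the two regions. This also covers full revelation, where no positivity is assumed. -/
theorem payoff_le_lcScheme {θ₀ A : ℝ} {s : ℝ → ℝ} (hθ₀ : θ₀ ∈ Icc 0 M.hi)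
    (hs : M.IsIC M.types s)
    (hA : ∫ x in θ₀..M.typeC θ₀, M.r θ₀ x = A * (M.typeC θ₀ - θ₀))
    (hle : ∀ x ∈ Icc 0 (M.typeC θ₀), ∫ y in x..M.typeC θ₀, M.r θ₀ y ≤ A * (M.typeC θ₀ - x))
    (hpos : M.hi ≤ M.typeC θ₀ → 0 ≤ A)
    (hanti : AntitoneOn (M.r θ₀) (Ioc (M.typeC θ₀) M.hi))
    (hbd : ∀ x ∈ Ioc (M.typeC θ₀) M.hi, M.r θ₀ x ≤ A) :
    M.payoff s ≤ M.payoff (M.lcScheme θ₀) := by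
  obtain ⟨t, ht, hts⟩ := hs.exists_extension
  rw [← M.payoff_congr hts]
  have hIC : ∀ T, M.IsIC (Icc 0 T) t := fun T => ht.subset fun x hx => hx.1
  have hC0 : 0 ≤ M.typeC θ₀ := hθ₀.1.trans (M.le_typeC hθ₀)
  have hbelow := M.integral_r_mul_le_below hθ₀ (hIC _) hA hle
  have hk : 0 ≤ M.kappa * (1 - M.F θ₀) :=
    mul_nonneg M.kappa_nonneg (sub_nonneg.2 (M.F_le_one θ₀))
  rcases le_or_gt M.hi (M.typeC θ₀) with h | h
  · have hgain := M.payoff_sub_le hθ₀ h (M.typeC_le_typeMax hθ₀) (hIC _)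
    have hU := M.utility_le_lcScheme hθ₀ le_rfl (M.typeC_le_typeMax hθ₀)
      (ht.mem (M.typeC θ₀) hC0)
    nlinarith [hpos h]
  · have hgain := M.payoff_sub_le hθ₀ le_rfl M.hi_le_typeMax (hIC _)
    have hU := M.utility_le_lcScheme hθ₀ h.le M.hi_le_typeMax (ht.mem M.hi M.hi_pos.le)
    have habove := M.integral_r_mul_le_above hθ₀ h (hIC _) hanti hbd
    have hrhi := M.neg_kappa_le_r_hi hθ₀ h
    have hi : ∀ a b, 0 ≤ a → a ≤ b → b ≤ M.hi →
        IntervalIntegrable (fun x => M.r θ₀ x * (t x - M.lcScheme θ₀ x)) volume a b := by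
      intro a b ha hab hb
      have hr := M.intervalIntegrable_r hθ₀ a b
      simp only [mul_sub]
      exact (((hIC b).subset (Icc_subset_Icc_left ha)).intervalIntegrable_mul hab hr).sub
        (((isIC_lcScheme hθ₀).subset
          (Icc_subset_Icc ha (hb.trans M.hi_le_typeMax))).intervalIntegrable_mul hab hr)
    rw [← intervalIntegral.integral_add_adjacent_intervals (hi 0 _ le_rfl hC0 h.le)
      (hi _ _ hC0 h.le le_rfl)] at hgain
    nlinarith

end RatingModel

/-! ### From conditions (S) and (C) to optimality. -/

namespace RatingModel

variable (M : RatingModel)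

lemma continuousOn_r {θ₀ : ℝ} (hθ₀ : θ₀ ∈ Icc 0 M.hi) :
    ContinuousOn (M.r θ₀) (Icc (max θ₀ M.lo) M.hi) := by
  have hmem : ∀ x ∈ Icc (max θ₀ M.lo) M.hi, θ₀ ≤ x ∧ x ∈ M.types := fun x hx =>
    ⟨(le_max_left _ _).trans hx.1, (le_max_right _ _).trans hx.1, hx.2⟩
  have hq : ContinuousOn (M.lcScheme θ₀) (Icc (max θ₀ M.lo) M.hi) := by
    have h1 : ContinuousOn (fun x => M.qf (max (M.typeC θ₀) x)) (Icc (max θ₀ M.lo) M.hi) :=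
      M.continuousOn_qf.comp (continuous_const.max continuous_id).continuousOn
        fun x hx => M.max_typeC_mem hθ₀ (M.types_subset (hmem x hx).2)
    exact h1.congr fun x hx => M.lcScheme_of_ge hθ₀ (hmem x hx).1
  have hn : ContinuousOn (fun x => M.netMarginal (M.lcScheme θ₀ x) x)
      (Icc (max θ₀ M.lo) M.hi) :=
    M.continuousOn_netMarginal.comp (f := fun x => (M.lcScheme θ₀ x, x)) (hq.prodMk continuousOn_id)
      fun x hx => ⟨M.lcScheme_mem hθ₀ (M.types_subset (hmem x hx).2), (hmem x hx).2⟩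
  have hf : ContinuousOn M.f (Icc (max θ₀ M.lo) M.hi) := M.f_cont.mono fun x hx => (hmem x hx).2
  have hF : ContinuousOn (fun x => M.kappa * (M.F x - M.F θ₀)) (Icc (max θ₀ M.lo) M.hi) :=
    (continuous_const.mul (M.continuous_F.sub continuous_const)).continuousOn
  exact ((hn.mul hf).sub hF).congr fun x _ => M.r_eq θ₀ x

lemma r_eq_zero {θ₀ θ : ℝ} (hθ₀ : θ₀ ≤ M.lo) (h : θ < M.lo) : M.r θ₀ θ = 0 := by
  rw [r_eq, M.f_zero θ fun hx => absurd hx.1 (not_le.2 h), M.F_of_le_lo hθ₀, M.F_of_le_lo h.le]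
  ring

lemma r_of_hi_lt {θ₀ θ : ℝ} (h : M.hi < θ) : M.r θ₀ θ = -(M.kappa * (1 - M.F θ₀)) := by
  rw [r_eq, M.f_zero θ fun hx => absurd hx.2 (not_le.2 h), M.F_of_hi_le h.le]
  ring

lemma A_eq {θ₀ : ℝ} (h : M.typeC θ₀ ≠ θ₀) :
    ∫ x in θ₀..M.typeC θ₀, M.r θ₀ x = M.A θ₀ * (M.typeC θ₀ - θ₀) := by
  have := sub_ne_zero.2 h
  rw [A, if_neg h]
  field_simp

lemma A_zero : M.A 0 = Function.rightLim (M.r 0) 0 := by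
  rw [A, if_pos M.typeC_zero]

variable {M}

lemma CondS.integral_eq {θ₀ : ℝ} (hθ₀ : θ₀ ∈ Icc 0 M.hi) :
    ∫ x in θ₀..M.typeC θ₀, M.r θ₀ x = M.A θ₀ * (M.typeC θ₀ - θ₀) := by
  rcases hθ₀.1.eq_or_lt with rfl | h
  · rw [typeC_zero]; simp
  · exact M.A_eq (M.lt_typeC hθ₀ h).ne'

/-- Otherwise the bunching region lies below the support, where `r` vanishes, contradicting `A > 0`.
Hence the truncation at `lo` in `typeL` never binds. -/
lemma CondS.lo_lt_typeC {θ₀ : ℝ} (h : M.CondS θ₀) (hθ₀ : θ₀ ∈ Icc 0 M.hi) (hpos : 0 < θ₀) :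
    M.lo < M.typeC θ₀ := by
  by_contra hc
  push Not at hc
  have hlt := M.lt_typeC hθ₀ hpos
  have h0 : ∫ x in θ₀..M.typeC θ₀, M.r θ₀ x = ∫ x in θ₀..M.typeC θ₀, (0 : ℝ) := by
    refine intervalIntegral.integral_congr_ae ?_
    filter_upwards [compl_mem_ae_iff.2 (measure_singleton M.lo)] with x hx hx'
    rw [uIoc_of_le hlt.le] at hx'
    exact M.r_eq_zero (hlt.le.trans hc) ((hx'.2.trans hc).lt_of_ne hx)
  rw [CondS.integral_eq hθ₀, intervalIntegral.integral_zero] at h0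
  exact (mul_pos h.1 (sub_pos.2 hlt)).ne' h0

lemma CondS.lo_eq_zero (h : M.CondS 0) : M.lo = 0 := by
  by_contra hc
  have hlo : 0 < M.lo := M.lo_nonneg.lt_of_ne' hc
  have hA := h.1
  have ht : Filter.Tendsto (M.r 0) (nhdsWithin 0 (Ioi 0)) (nhds 0) := by
    refine tendsto_const_nhds.congr' ?_
    filter_upwards [Ioo_mem_nhdsGT hlo] with x hx
    exact (M.r_eq_zero M.lo_nonneg hx.2).symm
  rw [A_zero, rightLim_eq_of_tendsto ht] at hA
  exact lt_irrefl _ hA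

lemma CondS.lo_le_typeC {θ₀ : ℝ} (h : M.CondS θ₀) (hθ₀ : θ₀ ∈ Icc 0 M.hi) :
    M.lo ≤ M.typeC θ₀ := by
  rcases hθ₀.1.eq_or_lt with rfl | hpos
  · rw [h.lo_eq_zero, typeC_zero]
  · exact (h.lo_lt_typeC hθ₀ hpos).le

lemma CondS.typeL_eq {θ₀ : ℝ} (h : M.CondS θ₀) (hθ₀ : θ₀ ∈ Icc 0 M.hi) :
    M.typeL θ₀ = min (M.typeC θ₀) M.hi :=
  max_eq_left (le_min (h.lo_le_typeC hθ₀) M.lo_lt_hi.le)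

lemma CondS.integral_le {θ₀ : ℝ} (h : M.CondS θ₀) (hθ₀ : θ₀ ∈ Icc 0 M.hi) :
    ∀ x ∈ Icc 0 (M.typeC θ₀), ∫ y in x..M.typeC θ₀, M.r θ₀ y ≤ M.A θ₀ * (M.typeC θ₀ - x) := by
  have hlow : ∀ x ∈ Icc 0 (min (M.typeC θ₀) M.hi),
      ∫ y in x..M.typeC θ₀, M.r θ₀ y ≤ M.A θ₀ * (M.typeC θ₀ - x) := by
    intro x hx
    have h1 := h.2 x (by rwa [h.typeL_eq hθ₀])
    have h2 := CondS.integral_eq hθ₀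
    rw [← intervalIntegral.integral_add_adjacent_intervals (M.intervalIntegrable_r hθ₀ θ₀ x)
      (M.intervalIntegrable_r hθ₀ x _)] at h2
    linarith
  intro x hx
  rcases le_or_gt x M.hi with hxh | hxh
  · exact hlow x ⟨hx.1, le_min hx.2 hxh⟩
  -- (S) is silent above `hi`, but there `r` is constant. The tail inequality at `hi` shows this
  -- constant to be at most `A`, which extends the bound to every later tail.
  · have hconst : ∀ y, M.hi ≤ y → y ≤ M.typeC θ₀ →
        ∫ z in y..M.typeC θ₀, M.r θ₀ z = (M.typeC θ₀ - y) * -(M.kappa * (1 - M.F θ₀)) := by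
      intro y hy hy'
      rw [intervalIntegral.integral_of_le hy', setIntegral_congr_fun measurableSet_Ioc
        (g := fun _ => -(M.kappa * (1 - M.F θ₀)))
        fun z hz => M.r_of_hi_lt (hy.trans_lt hz.1), ← intervalIntegral.integral_of_le hy',
        intervalIntegral.integral_const, smul_eq_mul]
    have hlt : M.hi < M.typeC θ₀ := hxh.trans_le hx.2
    have h1 := hlow M.hi ⟨M.hi_pos.le, le_min hlt.le le_rfl⟩
    rw [hconst _ le_rfl hlt.le, mul_comm] at h1
    have h2 := le_of_mul_le_mul_right h1 (sub_pos.2 hlt)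
    rw [hconst x hxh.le hx.2, mul_comm]
    exact mul_le_mul_of_nonneg_right h2 (sub_nonneg.2 hx.2)

/-- If `r` exceeded `A` somewhere above `typeC θ₀ > 0`, monotonicity and continuity would make it
exceed `A` just to the left of `typeC θ₀` as well, against the tail form of (S). For `θ₀ = 0`, `A`
is the right limit of a decreasing function. -/
lemma CondS.r_le {θ₀ : ℝ} (h : M.CondS θ₀) (hθ₀ : θ₀ ∈ Icc 0 M.hi)
    (hanti : AntitoneOn (M.r θ₀) (Ioc (M.typeC θ₀) M.hi)) :
    ∀ x ∈ Ioc (M.typeC θ₀) M.hi, M.r θ₀ x ≤ M.A θ₀ := by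
  intro y hy
  rcases hθ₀.1.eq_or_lt with rfl | hpos
  · have hcont := M.continuousOn_r hθ₀
    rw [h.lo_eq_zero, max_self] at hcont
    have ht : Filter.Tendsto (M.r 0) (nhdsWithin 0 (Ioi 0)) (nhds (M.r 0 0)) :=
      ((hcont 0 ⟨le_rfl, M.hi_pos.le⟩).mono Ioc_subset_Icc_self).mono_of_mem_nhdsWithin
        (Ioc_mem_nhdsGT M.hi_pos)
    rw [A_zero, rightLim_eq_of_tendsto ht]
    rw [typeC_zero] at hy hanti
    refine ge_of_tendsto ht ?_
    filter_upwards [Ioc_mem_nhdsGT hy.1] with x hx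
    exact hanti ⟨hx.1, hx.2.trans hy.2⟩ hy hx.2
  · by_contra hc
    push Not at hc
    have hChi : M.typeC θ₀ < M.hi := hy.1.trans_le hy.2
    have hlt : max θ₀ M.lo < M.typeC θ₀ := max_lt (M.lt_typeC hθ₀ hpos) (h.lo_lt_typeC hθ₀ hpos)
    have hcont := M.continuousOn_r hθ₀
    have hat : ContinuousAt (M.r θ₀) (M.typeC θ₀) :=
      (hcont _ ⟨hlt.le, hChi.le⟩).continuousAt (Icc_mem_nhds hlt hChi)
    have hge : M.r θ₀ y ≤ M.r θ₀ (M.typeC θ₀) := by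
      refine ge_of_tendsto (hat.tendsto.mono_left (nhdsWithin_le_nhds (s := Ioi (M.typeC θ₀)))) ?_
      filter_upwards [Ioc_mem_nhdsGT hy.1] with x hx
      exact hanti ⟨hx.1, hx.2.trans hy.2⟩ hy hx.2
    obtain ⟨l, hl, hlI⟩ := exists_Ioc_subset_of_mem_nhds
      (hat.eventually (lt_mem_nhds (hc.trans_le hge))) ⟨_, hlt⟩
    set x := max l (max θ₀ M.lo) with hx
    have hxC : x < M.typeC θ₀ := max_lt hl hlt
    have hx0 : 0 ≤ x := hθ₀.1.trans ((le_max_left _ _).trans (le_max_right _ _))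
    have h1 := h.integral_le hθ₀ x ⟨hx0, hxC.le⟩
    have h2 : ∫ _ in x..M.typeC θ₀, M.A θ₀ < ∫ z in x..M.typeC θ₀, M.r θ₀ z := by
      refine intervalIntegral.integral_lt_integral_of_continuousOn_of_le_of_exists_lt hxC
        continuousOn_const (hcont.mono (Icc_subset_Icc (le_max_right _ _) hChi.le))
        (fun z hz => (hlI ⟨(le_max_left _ _).trans_lt hz.1, hz.2⟩).le)
        ⟨_, ⟨hxC.le, le_rfl⟩, hlI ⟨hl, le_rfl⟩⟩
    rw [intervalIntegral.integral_const, smul_eq_mul] at h2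
    linarith

lemma CondS.antitoneOn {θ₀ : ℝ} (h : M.CondS θ₀) (hC : M.CondC θ₀) (hθ₀ : θ₀ ∈ Icc 0 M.hi) :
    AntitoneOn (M.r θ₀) (Ioc (M.typeC θ₀) M.hi) := by
  rcases le_or_gt M.hi (M.typeC θ₀) with h' | h'
  · rw [Ioc_eq_empty (not_lt.2 h')]
    simp [AntitoneOn]
  · rw [CondC, h.typeL_eq hθ₀, min_eq_left h'.le] at hC
    exact hC

lemma CondS.payoff_le {θ₀ : ℝ} {s : ℝ → ℝ} (h : M.CondS θ₀) (hθ₀ : θ₀ ∈ Icc 0 M.hi)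
    (hanti : AntitoneOn (M.r θ₀) (Ioc (M.typeC θ₀) M.hi)) (hs : M.IsIC M.types s) :
    M.payoff s ≤ M.payoff (M.lcScheme θ₀) :=
  M.payoff_le_lcScheme hθ₀ hs (CondS.integral_eq hθ₀) (h.integral_le hθ₀) (fun _ => h.1.le)
    hanti (h.r_le hθ₀ hanti)

lemma QuasiUnimodalAt.isOptimal {θ₀ : ℝ} (h : M.QuasiUnimodalAt θ₀) :
    M.IsOptimal (lowerCensorship (M.qi θ₀)) (M.lcScheme θ₀) := by
  obtain ⟨hθ₀, hS, hC⟩ := h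
  refine ⟨M.implements_lowerCensorship hθ₀, fun S' π' q' hq => ?_⟩
  obtain ⟨P, ω, hE⟩ := hq
  exact hS.payoff_le hθ₀ (hS.antitoneOn hC hθ₀) hE.isIC

lemma QuasiIncreasingAt.isOptimal {θ₀ : ℝ} (h : M.QuasiIncreasingAt θ₀) :
    M.IsOptimal (passFail (M.qi θ₀)) (M.pfScheme θ₀) := by
  obtain ⟨hθ₀, hS, hC⟩ := h
  refine ⟨M.implements_passFail hθ₀, fun S' π' q' hq => ?_⟩
  obtain ⟨P, ω, hE⟩ := hq
  have hanti : AntitoneOn (M.r θ₀) (Ioc (M.typeC θ₀) M.hi) := by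
    rw [Ioc_eq_empty (not_lt.2 hC)]
    simp [AntitoneOn]
  refine (hS.payoff_le hθ₀ hanti hE.isIC).trans_eq (M.payoff_congr fun θ hθ => ?_)
  rcases lt_or_ge θ θ₀ with h1 | h1
  · rw [M.lcScheme_of_lt h1, pfScheme, if_pos h1]
  · rw [M.lcScheme_of_ge hθ₀ h1, max_eq_left (hθ.2.trans hC), M.qf_typeC hθ₀, pfScheme,
      if_neg (not_lt.2 h1)]

lemma noExclusion_lcScheme {θ₀ : ℝ} (hθ₀ : θ₀ ∈ Icc 0 M.hi) (hlo : θ₀ ≤ M.lo) :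
    M.NoExclusion (M.lcScheme θ₀) := by
  intro θ hθ hpos
  have hθ' := M.types_subset hθ
  rw [M.lcScheme_of_ge hθ₀ (hlo.trans hθ.1), ← M.qf_zero]
  exact M.strictMonoOn_qf ⟨le_rfl, hθ'.1.trans hθ'.2⟩ (M.max_typeC_mem hθ₀ hθ')
    (hpos.trans_le (le_max_right _ _))

lemma isOptimal_fullyRevealing (h : AntitoneOn (M.r 0) (Ici 0)) :
    M.IsOptimal fullyRevealing M.qf := by
  refine ⟨M.implements_fullyRevealing, fun S' π' q' hq => ?_⟩
  obtain ⟨P, ω, hE⟩ := hq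
  have hθ₀ : (0 : ℝ) ∈ Icc 0 M.hi := ⟨le_rfl, M.hi_pos.le⟩
  have h0 := M.typeC_zero
  have key : M.payoff q' ≤ M.payoff (M.lcScheme 0) := by
    -- The region below `typeC 0 = 0` is a single point, so the multiplier only has to bound `r`
    -- from above; its value at `0` does so by monotonicity.
    refine M.payoff_le_lcScheme (A := M.r 0 0) hθ₀ hE.isIC ?_ ?_ ?_ ?_ ?_
    · simp [h0]
    · rw [h0]
      intro x hx
      rw [le_antisymm hx.2 hx.1]
      simp
    · rw [h0]
      exact fun h' => absurd h' (not_le.2 M.hi_pos)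
    · rw [h0]
      exact h.mono fun x hx => hx.1.le
    · rw [h0]
      exact fun x hx => h self_mem_Ici hx.1.le hx.1.le
  exact key.trans_eq (M.payoff_congr fun θ hθ =>
    M.lcScheme_zero_of_nonneg (M.lo_nonneg.trans hθ.1))

end RatingModel
end

theorem mainTheorem3 (M : RatingModel) :
    (∀ θ₀ : ℝ, M.QuasiUnimodalAt θ₀ →
      M.IsOptimal (lowerCensorship (M.qi θ₀)) (M.lcScheme θ₀)) ∧
    (∀ θ₀ : ℝ, M.QuasiIncreasingAt θ₀ →
      M.IsOptimal (passFail (M.qi θ₀)) (M.pfScheme θ₀)) ∧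
    (∀ θ₀ : ℝ, M.QuasiDecreasingAt θ₀ →
      M.IsOptimal (lowerCensorship (M.qi θ₀)) (M.lcScheme θ₀) ∧
        M.NoExclusion (M.lcScheme θ₀)) ∧
    (AntitoneOn (M.r 0) (Ici 0) → M.IsOptimal fullyRevealing M.qf) :=
  ⟨fun _ h => h.isOptimal, fun _ h => h.isOptimal,
    fun _ h => ⟨RatingModel.QuasiUnimodalAt.isOptimal ⟨h.1, h.2.1, h.2.2.1⟩,
      RatingModel.noExclusion_lcScheme h.1 h.2.2.2⟩,
    RatingModel.isOptimal_fullyRevealing⟩
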